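/- **Setting.** Fix covariance matrices $\Sigma_S,\Sigma_T\in\mathbb R^{d\times d}$ (positive semidefinite), a noise level $\sigma\ge 0$, sample sizes $n_S\ge 0$, $n_T\ge 1$ and $\Delta\ge 0$. For a parameter matrix $\theta$ and a regression function $f(\theta;\cdot):\mathbb R^d\to\mathbb R^k$, let $\mathbb P_\theta$ (resp. $\mathbb Q_\theta$) be the law of $(x,y)$ with $x\sim\mathcal N(0,\Sigma_S)$ (resp. $x\sim\mathcal N(0,\Sigma_T)$) and $y=f(\theta;x)+w$, where $w\sim\mathcal N(0,\sigma^2 I_k)$ is independent of $x$. With $\varphi(t)=\max(t,0)$ applied entrywise, three models are considered: 1. *linear*: $f(W;x)=Wx$, $W\in\mathbb R^{k\times d}$; 2. *one-hidden-layer ReLU net with fixed output layer* $V\in\mathbb R^{k\times\ell}$: $f(W;x)=V\varphi(Wx)$, $W\in\mathbb R^{\ell\times d}$; 3. *one-hidden-layer ReLU net with fixed input layer* $W\in\mathbb R^{\ell\times d}$: $f(V;x)=V\varphi(Wx)$, $V\in\mathbb R^{k\times\ell}$. For $\Sigma\in\{\Sigma_S,\Sigma_T\}$ let $a_i$ be the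 $i$-th row of $W\Sigma^{1/2}$, $\gamma_{ij}=\frac{\langle a_i,a_j\rangle}{\|a_i\|_2\|a_j\|_2}$, and $$\widetilde\Sigma=\Big[\tfrac12\|a_i\|_2\|a_j\|_2\,\tfrac{\sqrt{1-\gamma_{ij}^2}+(\pi-\arccos\gamma_{ij})\gamma_{ij}}{\pi}\Big]_{ij}$$ (an entry being $0$ if $a_i=0$ or $a_j=0$); this defines $\widetilde\Sigma_S$ and $\widetilde\Sigma_T$. Below, $\|\cdot\|$ is the operator norm, $\|\cdot\|_F$ the Frobenius norm, and $A^{-1/2}$ denotes the (Moore–Penrose pseudo-)inverse of $A^{1/2}$. The transfer distance $\rho$, the effective dimension $D$ and the transfer coefficients $r_S,r_T$ are: * models 1 and 2: $\rho(W_S,W_T)=\|\Sigma_T^{1/2}(W_S-W_T)^{\mathsf T}\|_F$; model 3: $\rho(V_S,V_T)=\|\widetilde\Sigma_T^{1/2}(V_S-V_T)^{\mathsf T}\|_F$; * model 1: $D=\operatorname{rank}(\Sigma_T)k-1$, $r_S=\|\Sigma_S^{1/2}\Sigma_T^{-1/2}\|^2$, $r_T=1$; * model 2: $D=\operatorname{rank}(\Sigma_T)\ell-1$,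 $r_S=\|\Sigma_S^{1/2}\Sigma_T^{-1/2}\|^2\|V\|^2$, $r_T=\|V\|^2$; * model 3: $D=\operatorname{rank}(\widetilde\Sigma_T)k-1$, $r_S=\|\widetilde\Sigma_S^{1/2}\widetilde\Sigma_T^{-1/2}\|^2$, $r_T=1$. Let $\mathcal P_\Delta=\{(\mathbb P_{\theta_S},\mathbb Q_{\theta_T}):\rho(\theta_S,\theta_T)\le\Delta\}$ and define the minimax risk $$\mathcal R_T(\mathcal P_\Delta)=\inf_{\widehat\theta_T}\ \sup_{(\mathbb P_{\theta_S},\mathbb Q_{\theta_T})\in\mathcal P_\Delta}\ \mathbb E_{S\sim\mathbb P_{\theta_S}^{n_S}}\,\mathbb E_{S'\sim\mathbb Q_{\theta_T}^{n_T}}\,\mathbb E_{(x,y)\sim\mathbb Q_{\theta_T}}\big\|y-f(\widehat\theta_T(S,S');x)\big\|_2^2,$$ the infimum being over all measurable functions $\widehat\theta_T$ of the $n_S$ source and $n_T$ target samples with values in the parameter space. **Theorem.** If $D\ge 20$ in the model under consideration, then * in models 1 and 3, $\ \mathcal R_T(\mathcal P_\Delta)\ge B+k\sigma^2$; * in model 2,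 $\ \mathcal R_T(\mathcal P_\Delta)\ge\frac14\sigma_{\min}(V)^2B+k\sigma^2$, where $\sigma_{\min}(V)=\min_{\|z\|_2=1}\|Vz\|_2$ is the minimum singular value of $V$ (so $0$ if $k<\ell$; for $V=0$ the bound is read as $k\sigma^2$) and $$B=\begin{cases}\dfrac{\sigma^2D}{256\,r_Tn_T}, & \Delta\ge\sqrt{\dfrac{\sigma^2D\log 2}{r_Tn_T}},\\[2mm] \dfrac{\Delta^2}{100}\Big(1-0.8\,\dfrac{r_Tn_T\Delta^2}{\sigma^2D}\Big), & \dfrac1{45}\sqrt{\dfrac{\sigma^2D}{r_Sn_S+r_Tn_T}}\le\Delta<\sqrt{\dfrac{\sigma^2D\log 2}{r_Tn_T}},\\[2mm] \dfrac{\Delta^2}{1000}+\dfrac{6}{1000}\,\dfrac{D\sigma^2}{r_Sn_S+r_Tn_T}, & \Delta<\dfrac1{45}\sqrt{\dfrac{\sigma^2D}{r_Sn_S+r_Tn_T}}.\end{cases}$$ -/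

import Mathlib

open MeasureTheory ProbabilityTheory
open scoped ENNReal Matrix MatrixOrder

noncomputable section

namespace TransferLearning

/-- The Frobenius norm of a real matrix. -/
def frobNorm {m n : ℕ} (A : Matrix (Fin m) (Fin n) ℝ) : ℝ :=
  √(∑ i, ∑ j, A i j ^ 2)

/-- The operator (spectral) norm of a real matrix, with Euclidean norms on both sides. -/
def opNorm {m n : ℕ} (A : Matrix (Fin m) (Fin n) ℝ) : ℝ :=
  ‖LinearMap.toContinuousLinearMap (Matrix.toEuclideanLin A)‖

/-- The minimum singular value `σ_min(V)` of a `k × ℓ` matrix: the last of the `ℓ` singular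
values `σ₁ ≥ … ≥ σ_ℓ ≥ 0` (square roots of the eigenvalues of `Vᵀ V`). It is the largest `c`
with `‖V z‖ ≥ c ‖z‖` for all `z`; in particular it is `0` if `k < ℓ`. -/
def minSingularValue {k l : ℕ} (V : Matrix (Fin k) (Fin l) ℝ) : ℝ :=
  (Matrix.toEuclideanLin V).singularValues (l - 1)

/-- `A^{-1/2}` for a positive semidefinite matrix `A`. Eigenvalues `0` are sent to `0`, so this
is the Moore–Penrose inverse of `A^{1/2}`, and the inverse of `A^{1/2}` if `A` is invertible. -/
def invSqrt {n : ℕ} (A : Matrix (Fin n) (Fin n) ℝ) : Matrix (Fin n) (Fin n) ℝ :=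
  cfc (fun t : ℝ => (√t)⁻¹) A

/-- The ReLU activation function, applied to every coordinate. -/
def reluVec {n : ℕ} (x : EuclideanSpace ℝ (Fin n)) : EuclideanSpace ℝ (Fin n) :=
  WithLp.toLp 2 fun i => max (x i) 0

/-! ### The three regression functions -/

/-- Linear model `f(W; x) = W x`. -/
def linearModel {k d : ℕ} (W : Matrix (Fin k) (Fin d) ℝ) (x : EuclideanSpace ℝ (Fin d)) :
    EuclideanSpace ℝ (Fin k) :=
  Matrix.toEuclideanLin W x

/-- One-hidden-layer network with fixed hidden-to-output layer `V`: `f(W; x) = V φ(W x)`. -/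
def fixedOutputModel {k l d : ℕ} (V : Matrix (Fin k) (Fin l) ℝ)
    (W : Matrix (Fin l) (Fin d) ℝ) (x : EuclideanSpace ℝ (Fin d)) : EuclideanSpace ℝ (Fin k) :=
  Matrix.toEuclideanLin V (reluVec (Matrix.toEuclideanLin W x))

/-- One-hidden-layer network with fixed input-to-hidden layer `W`: `f(V; x) = V φ(W x)`. -/
def fixedInputModel {k l d : ℕ} (W : Matrix (Fin l) (Fin d) ℝ)
    (V : Matrix (Fin k) (Fin l) ℝ) (x : EuclideanSpace ℝ (Fin d)) : EuclideanSpace ℝ (Fin k) :=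
  Matrix.toEuclideanLin V (reluVec (Matrix.toEuclideanLin W x))

/-! ### Data distributions and the minimax risk -/

/-- A labelled example: a feature in `ℝ^d` and a label in `ℝ^k`. -/
abbrev Example (d k : ℕ) : Type := EuclideanSpace ℝ (Fin d) × EuclideanSpace ℝ (Fin k)

/-- Joint law of `(x, y)` with `x ∼ N(0, S)` and `y = f x + w`, where `w ∼ N(0, σ² I_k)` is
independent of `x`. -/
def dataLaw {d k : ℕ} (S : Matrix (Fin d) (Fin d) ℝ) (σ : ℝ)
    (f : EuclideanSpace ℝ (Fin d) → EuclideanSpace ℝ (Fin k)) : Measure (Example d k) :=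
  ((multivariateGaussian 0 S).prod
    (multivariateGaussian 0 (σ ^ 2 • (1 : Matrix (Fin k) (Fin k) ℝ)))).map
      fun p => (p.1, f p.1 + p.2)

/-- The class `𝒫_Δ` of pairs (source law, target law) with transfer distance at most `Δ`; the
parameters are `p × q` matrices, `f` is the regression function, `ρ` the transfer distance. -/
def pairClass {d k p q : ℕ} (covS covT : Matrix (Fin d) (Fin d) ℝ) (σ : ℝ)
    (f : Matrix (Fin p) (Fin q) ℝ → EuclideanSpace ℝ (Fin d) → EuclideanSpace ℝ (Fin k))
    (ρ : Matrix (Fin p) (Fin q) ℝ → Matrix (Fin p) (Fin q) ℝ → ℝ) (Δ : ℝ) :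
    Set (Measure (Example d k) × Measure (Example d k)) :=
  {PQ | ∃ θS θT : Matrix (Fin p) (Fin q) ℝ,
    ρ θS θT ≤ Δ ∧ PQ.1 = dataLaw covS σ (f θS) ∧ PQ.2 = dataLaw covT σ (f θT)}

/-- Target generalization error `E_Q ‖y - f(θ; x)‖²` of the parameter `θ`. -/
def genError {d k p q : ℕ}
    (f : Matrix (Fin p) (Fin q) ℝ → EuclideanSpace ℝ (Fin d) → EuclideanSpace ℝ (Fin k))
    (Q : Measure (Example d k)) (θ : Matrix (Fin p) (Fin q) ℝ) : ℝ≥0∞ :=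
  ∫⁻ z, ‖z.2 - f θ z.1‖ₑ ^ 2 ∂Q

/-- An estimator of the target parameter: a (Borel) measurable function of the `nS` source and
the `nT` target examples. Measurability into matrices is stated entrywise. -/
def IsEstimator {d k p q nS nT : ℕ}
    (est : (Fin nS → Example d k) → (Fin nT → Example d k) → Matrix (Fin p) (Fin q) ℝ) : Prop :=
  ∀ i j, Measurable fun s : (Fin nS → Example d k) × (Fin nT → Example d k) => est s.1 s.2 i j

/-- The transfer learning minimax risk: the infimum over estimators of the supremum over
`𝒫_Δ` of the expected target generalization error, for `nS` i.i.d. source examples and `nT`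
i.i.d. target examples, as an extended nonnegative real. -/
def minimaxRisk {d k p q : ℕ} (covS covT : Matrix (Fin d) (Fin d) ℝ) (σ : ℝ)
    (f : Matrix (Fin p) (Fin q) ℝ → EuclideanSpace ℝ (Fin d) → EuclideanSpace ℝ (Fin k))
    (ρ : Matrix (Fin p) (Fin q) ℝ → Matrix (Fin p) (Fin q) ℝ → ℝ) (nS nT : ℕ) (Δ : ℝ) : ℝ≥0∞ :=
  ⨅ est : {e : (Fin nS → Example d k) → (Fin nT → Example d k) → Matrix (Fin p) (Fin q) ℝ //
      IsEstimator e},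
    ⨆ PQ ∈ pairClass covS covT σ f ρ Δ,
      ∫⁻ s, ∫⁻ t, genError f PQ.2 (est.1 s t)
        ∂(Measure.pi fun _ : Fin nT => PQ.2) ∂(Measure.pi fun _ : Fin nS => PQ.1)

/-! ### Transfer distance, effective dimension, transfer coefficients -/

/-- `‖A^{1/2} (M₁ - M₂)ᵀ‖_F`. -/
def transferDist {m n : ℕ} (A : Matrix (Fin n) (Fin n) ℝ) (M₁ M₂ : Matrix (Fin m) (Fin n) ℝ) :
    ℝ :=
  frobNorm (CFC.sqrt A * (M₁ - M₂)ᵀ)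

/-- The matrix `Σ̃` built from the rows `a_i` of `W S^{1/2}`: its `(i, j)` entry is
`½ ‖a_i‖ ‖a_j‖ (√(1 - γ²) + (π - arccos γ) γ) / π` with `γ = ⟨a_i, a_j⟩ / (‖a_i‖ ‖a_j‖)`
(the entry is `0` if `a_i = 0` or `a_j = 0`). -/
def reluCov {l d : ℕ} (W : Matrix (Fin l) (Fin d) ℝ) (S : Matrix (Fin d) (Fin d) ℝ) :
    Matrix (Fin l) (Fin l) ℝ :=
  Matrix.of fun i j =>
    let a : Fin l → EuclideanSpace ℝ (Fin d) := fun i => WithLp.toLp 2 ((W * CFC.sqrt S) i)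
    let γ : ℝ := inner ℝ (a i) (a j) / (‖a i‖ * ‖a j‖)
    1 / 2 * ‖a i‖ * ‖a j‖ * ((√(1 - γ ^ 2) + (Real.pi - Real.arccos γ) * γ) / Real.pi)

/-- The effective dimension `rank(A) m - 1`, as a real number. -/
def effDim {n : ℕ} (A : Matrix (Fin n) (Fin n) ℝ) (m : ℕ) : ℝ := (A.rank : ℝ) * m - 1

/-- `‖A_S^{1/2} A_T^{-1/2}‖²`. -/
def covRatio {n : ℕ} (AS AT : Matrix (Fin n) (Fin n) ℝ) : ℝ :=
  opNorm (CFC.sqrt AS * invSqrt AT) ^ 2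

/-- The three-regime function `B`. -/
def lowerB (σ D rS rT : ℝ) (nS nT : ℕ) (Δ : ℝ) : ℝ :=
  if √(σ ^ 2 * D * Real.log 2 / (rT * nT)) ≤ Δ then
    σ ^ 2 * D / (256 * rT * nT)
  else if 1 / 45 * √(σ ^ 2 * D / (rS * nS + rT * nT)) ≤ Δ then
    1 / 100 * Δ ^ 2 * (1 - 0.8 * (rT * nT * Δ ^ 2 / (σ ^ 2 * D)))
  else
    Δ ^ 2 / 1000 + 6 / 1000 * (D * σ ^ 2 / (rS * nS + rT * nT))

end TransferLearning

end

namespace TransferLearning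

/-! ### Products of densities -/

/-! The proof is Assouad's method on a hypercube of parameters. In each model the target mean square
of f(M; x) - f(M'; x) lies between c ρ² and s ρ², and its source mean square is at most s times the
analogue of ρ² built from the source covariance. Whitening (`exists_whitened_coordinates`) turns ρ
into a Euclidean distance in N = D + 1 coordinates. A sign vector b then gives the target parameter
δb and the source parameter τδb, at transfer distance at most |1 - τ| δ √N.

Flipping one sign barely changes the law of the data. The affinity (integral of the geometric mean
of two densities) of one example is explicit for Gaussian noise and bounded below through exp(-t) ≥
1 - t (`le_lintegral_affinity`); Bernoulli's inequality passes to the samples. By `assouad`, no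
estimator has average squared coordinate error below N δ² (1 - (τ² r_S n_S + r_T n_T) δ²/σ²), with
r_S = s · `covRatio` and r_T = s. The label noise adds exactly kσ² (`hypercube_le_minimaxRisk`).

Two values of τ suffice. For τ = 0 the source law is the same at all vertices, so source data are
worthless, but δ is limited by Δ. For τ = 1 the transfer distance is zero, but source data inform.
Optimising δ gives the three regimes (`lowerB_le_hypercube`).

The models enter only through s and c. Linear: s = c = 1. Fixed output layer: s = ‖V‖² since ReLU is
1-Lipschitz, and c = σ_min(V)²/4 by the symmetry x ↦ -x. Fixed input layer: s = c = 1, because Σ̃ is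
the second-moment matrix of the hidden layer, which is the arc-cosine kernel formula
(`integral_relu_inner_mul_relu_inner`). -/

theorem lintegral_pi_prod_restrict {n : ℕ} {E : Type*} [MeasurableSpace E]
    (μ : Measure E) [SigmaFinite μ] {f : E → ℝ≥0∞} (hf : Measurable f) (s : Fin n → Set E) :
    ∫⁻ x : Fin n → E, ∏ i, f (x i) ∂(Measure.pi fun i => μ.restrict (s i)) =
      ∏ i, ∫⁻ x in s i, f x ∂μ := by
  induction n with
  | zero => simp
  | succ n ih =>
    have hmp := (measurePreserving_piFinSuccAbove (fun i : Fin (n + 1) => μ.restrict (s i)) 0).symm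
    rw [← hmp.lintegral_comp_emb (MeasurableEquiv.measurableEmbedding _)]
    calc
      _ = ∫⁻ x : E × (Fin n → E), f x.1 * ∏ i : Fin n, f (x.2 i)
            ∂((μ.restrict (s 0)).prod (Measure.pi (fun i : Fin n ↦ μ.restrict (s i.succ)))) := by
          refine lintegral_congr fun x => ?_
          rw [Fin.prod_univ_succ]
          rfl
      _ = (∫⁻ x in s 0, f x ∂μ) * ∏ i : Fin n, ∫⁻ x in s i.succ, f x ∂μ := by
          rw [← ih, lintegral_prod_mul hf.aemeasurable (g := fun y : Fin n → E => ∏ i, f (y i))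
              (Finset.measurable_prod _ fun i _ => hf.comp (measurable_pi_apply i)).aemeasurable]
      _ = _ := by rw [Fin.prod_univ_succ]

theorem lintegral_pi_prod {n : ℕ} {E : Type*} [MeasurableSpace E]
    (μ : Measure E) [SigmaFinite μ] {f : E → ℝ≥0∞} (hf : Measurable f) :
    ∫⁻ x : Fin n → E, ∏ i, f (x i) ∂(Measure.pi fun _ => μ) = (∫⁻ x, f x ∂μ) ^ n := by
  simpa using lintegral_pi_prod_restrict μ hf fun _ : Fin n => Set.univ

/-- Measures on a finite product are determined by boxes, and on a box the integral of a product
density factorises; this is why the factorisation above carries restrictions. -/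
theorem pi_withDensity {n : ℕ} {E : Type*} [MeasurableSpace E]
    (μ : Measure E) [SigmaFinite μ] {f : E → ℝ≥0∞} (hf : Measurable f)
    [SigmaFinite (μ.withDensity f)] :
    Measure.pi (fun _ : Fin n => μ.withDensity f) =
      (Measure.pi fun _ : Fin n => μ).withDensity fun x => ∏ i, f (x i) := by
  refine Measure.pi_eq (μ := fun _ : Fin n => μ.withDensity f) fun s hs => ?_
  rw [withDensity_apply _ (MeasurableSet.univ_pi hs), Measure.restrict_pi_pi,
    lintegral_pi_prod_restrict _ hf]
  exact Finset.prod_congr rfl fun i _ => (withDensity_apply _ (hs i)).symm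

/-! ### The isotropic Gaussian -/

theorem multivariateGaussian_smul_one {k : ℕ} (v : NNReal) :
    multivariateGaussian 0 ((v : ℝ) • (1 : Matrix (Fin k) (Fin k) ℝ)) =
      (Measure.pi fun _ : Fin k => gaussianReal 0 v).map (WithLp.toLp 2) := by
  have hps : ((v : ℝ) • (1 : Matrix (Fin k) (Fin k) ℝ)).PosSemidef :=
    Matrix.PosSemidef.one.smul v.2
  apply Measure.ext_of_charFun
  ext t
  rw [charFun_multivariateGaussian hps]
  simp_rw [charFun_pi, charFun_gaussianReal, ← Complex.exp_sum]
  congr 1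
  simp [Matrix.smul_mulVec, dotProduct, Finset.sum_div]
  refine Finset.sum_congr rfl fun i _ => by ring

/-- The density of `N(0, v I)` with respect to Lebesgue measure. -/
noncomputable def isoDensity {k : ℕ} (v : NNReal) (y : EuclideanSpace ℝ (Fin k)) : ℝ≥0∞ :=
  ∏ j, gaussianPDF 0 v (y j)

@[fun_prop]
theorem measurable_isoDensity {k : ℕ} (v : NNReal) :
    Measurable (isoDensity v : EuclideanSpace ℝ (Fin k) → ℝ≥0∞) := by
  unfold isoDensity
  exact Finset.measurable_prod _ fun i _ => (measurable_gaussianPDF 0 v).comp (by fun_prop)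

theorem multivariateGaussian_eq_withDensity {k : ℕ} {v : NNReal} (hv : v ≠ 0) :
    multivariateGaussian 0 ((v : ℝ) • (1 : Matrix (Fin k) (Fin k) ℝ)) =
      volume.withDensity (isoDensity v) := by
  have : SigmaFinite ((volume : Measure ℝ).withDensity (gaussianPDF 0 v)) := by
    rw [← gaussianReal_of_var_ne_zero _ hv]; infer_instance
  rw [multivariateGaussian_smul_one, gaussianReal_of_var_ne_zero _ hv,
    pi_withDensity _ (measurable_gaussianPDF 0 v)]
  ext s hs
  rw [Measure.map_apply (by fun_prop) hs, withDensity_apply _ (hs.preimage (by fun_prop)),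
    withDensity_apply _ hs, ← (PiLp.volume_preserving_toLp (Fin k)).setLIntegral_comp_preimage
      hs (measurable_isoDensity v)]
  rfl

theorem lintegral_isoDensity {k : ℕ} {v : NNReal} (hv : v ≠ 0) :
    ∫⁻ y : EuclideanSpace ℝ (Fin k), isoDensity v y = 1 := by
  rw [← setLIntegral_univ, ← withDensity_apply _ MeasurableSet.univ,
    ← multivariateGaussian_eq_withDensity hv, measure_univ]

theorem isoDensity_ne_top {k : ℕ} (v : NNReal) (y : EuclideanSpace ℝ (Fin k)) :
    isoDensity v y ≠ ⊤ := by
  simp [isoDensity, ENNReal.prod_ne_top, gaussianPDF_ne_top]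

/-- The parallelogram identity in the exponent: the geometric mean of two translates of a Gaussian
density is the translate to the midpoint, damped by a constant. Squaring avoids roots of densities.
-/
theorem gaussianPDFReal_mul_gaussianPDFReal (v : NNReal) (s t : ℝ) :
    gaussianPDFReal 0 v s * gaussianPDFReal 0 v t =
      (Real.exp (-((s - t) ^ 2 / (8 * v))) * gaussianPDFReal 0 v ((s + t) / 2)) ^ 2 := by
  have : Real.exp (-(s - 0) ^ 2 / (2 * v)) * Real.exp (-(t - 0) ^ 2 / (2 * v)) =
      (Real.exp (-((s - t) ^ 2 / (8 * v))) * Real.exp (-((s + t) / 2 - 0) ^ 2 / (2 * v))) ^ 2 := by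
    rw [← Real.exp_add, ← Real.exp_add, ← Real.exp_nat_mul]
    congr 1
    rcases eq_or_ne (v : ℝ) 0 with h | h
    · simp [h]
    · field_simp
      push_cast
      ring
  simp only [gaussianPDFReal]
  linear_combination ((√(2 * Real.pi * v))⁻¹) ^ 2 * this

theorem isoDensity_mul_isoDensity {k : ℕ} (v : NNReal) (y a b : EuclideanSpace ℝ (Fin k)) :
    isoDensity v (y - a) * isoDensity v (y - b) =
      (ENNReal.ofReal (Real.exp (-(‖a - b‖ ^ 2 / (8 * v)))) *
        isoDensity v (y - (2⁻¹ : ℝ) • (a + b))) ^ 2 := by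
  have hexp : Real.exp (-(‖a - b‖ ^ 2 / (8 * v))) =
      ∏ j, Real.exp (-((a j - b j) ^ 2 / (8 * v))) := by
    rw [← Real.exp_sum, EuclideanSpace.real_norm_sq_eq, Finset.sum_neg_distrib, Finset.sum_div]
    rfl
  rw [hexp, ENNReal.ofReal_prod_of_nonneg fun _ _ => (Real.exp_pos _).le]
  simp only [isoDensity]
  rw [← Finset.prod_mul_distrib, ← Finset.prod_mul_distrib, ← Finset.prod_pow]
  refine Finset.prod_congr rfl fun j _ => ?_
  simp only [gaussianPDF]
  rw [← ENNReal.ofReal_mul (gaussianPDFReal_nonneg _ _ _),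
    ← ENNReal.ofReal_mul (Real.exp_pos _).le,
    ← ENNReal.ofReal_pow (mul_nonneg (Real.exp_pos _).le (gaussianPDFReal_nonneg _ _ _)),
    gaussianPDFReal_mul_gaussianPDFReal]
  simp only [PiLp.sub_apply, PiLp.smul_apply, PiLp.add_apply, smul_eq_mul]
  congr 6 <;> ring

/-! ### The law of a labelled example -/

/-- The base measure dominating all laws with the same feature covariance. -/
noncomputable def baseMeasure {d : ℕ} (S : Matrix (Fin d) (Fin d) ℝ) (k : ℕ) :
    Measure (Example d k) :=
  (multivariateGaussian 0 S).prod volume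

instance {d k : ℕ} (S : Matrix (Fin d) (Fin d) ℝ) : SigmaFinite (baseMeasure S k) := by
  unfold baseMeasure; infer_instance

/-- The likelihood of a labelled example. -/
noncomputable def likelihood {d k : ℕ} (v : NNReal)
    (f : EuclideanSpace ℝ (Fin d) → EuclideanSpace ℝ (Fin k)) (z : Example d k) : ℝ≥0∞ :=
  isoDensity v (z.2 - f z.1)

section DataLaw

variable {d k : ℕ} {f g : EuclideanSpace ℝ (Fin d) → EuclideanSpace ℝ (Fin k)}

theorem measurable_likelihood (v : NNReal) (hf : Measurable f) : Measurable (likelihood v f) :=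
  (measurable_isoDensity v).comp (by fun_prop)

theorem lintegral_dataLaw (S : Matrix (Fin d) (Fin d) ℝ) (σ : ℝ) (hf : Measurable f)
    {F : Example d k → ℝ≥0∞} (hF : Measurable F) :
    ∫⁻ z, F z ∂(dataLaw S σ f) =
      ∫⁻ x, ∫⁻ w, F (x, f x + w) ∂(multivariateGaussian 0 (σ ^ 2 • 1))
        ∂(multivariateGaussian 0 S) := by
  rw [dataLaw, lintegral_map hF (by fun_prop), lintegral_prod _ (by fun_prop)]

theorem isProbabilityMeasure_dataLaw (S : Matrix (Fin d) (Fin d) ℝ) (σ : ℝ) (hf : Measurable f) :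
    IsProbabilityMeasure (dataLaw S σ f) :=
  Measure.isProbabilityMeasure_map (by fun_prop)

theorem dataLaw_eq_withDensity (S : Matrix (Fin d) (Fin d) ℝ) {v : NNReal} (hv : v ≠ 0) {σ : ℝ}
    (hσ : σ ^ 2 = v) (hf : Measurable f) :
    dataLaw S σ f = (baseMeasure S k).withDensity (likelihood v f) := by
  have hl := measurable_likelihood v hf
  ext s hs
  have hs' : Measurable (s.indicator (1 : Example d k → ℝ≥0∞)) := measurable_one.indicator hs
  rw [← lintegral_indicator_one hs, lintegral_dataLaw S σ hf hs', withDensity_apply _ hs,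
    ← lintegral_indicator hs, baseMeasure, lintegral_prod _ (by fun_prop (disch := assumption)), hσ,
    multivariateGaussian_eq_withDensity hv]
  refine lintegral_congr fun x => ?_
  rw [lintegral_withDensity_eq_lintegral_mul _ (by fun_prop) (by fun_prop)]
  -- Translation invariance of Lebesgue measure turns the label variable into the noise variable.
  conv_rhs => rw [← lintegral_add_left_eq_self _ (f x)]
  refine lintegral_congr fun y => ?_
  simp [likelihood, Set.indicator]

theorem lintegral_likelihood (S : Matrix (Fin d) (Fin d) ℝ) {v : NNReal} (hv : v ≠ 0)
    (hf : Measurable f) : ∫⁻ z, likelihood v f z ∂(baseMeasure S k) = 1 := by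
  have := isProbabilityMeasure_dataLaw S (√v) hf
  rw [← setLIntegral_univ, ← withDensity_apply _ MeasurableSet.univ,
    ← dataLaw_eq_withDensity S hv (Real.sq_sqrt v.2) hf, measure_univ]

/-- The geometric mean of two likelihoods. -/
noncomputable def affinity (v : NNReal)
    (f g : EuclideanSpace ℝ (Fin d) → EuclideanSpace ℝ (Fin k)) (z : Example d k) : ℝ≥0∞ :=
  ENNReal.ofReal (Real.exp (-(‖f z.1 - g z.1‖ ^ 2 / (8 * v)))) *
    likelihood v (fun x => (2⁻¹ : ℝ) • (f x + g x)) z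

theorem likelihood_mul_likelihood (v : NNReal) (z : Example d k) :
    likelihood v f z * likelihood v g z = affinity v f g z ^ 2 :=
  isoDensity_mul_isoDensity v _ _ _

theorem measurable_affinity (v : NNReal) (hf : Measurable f) (hg : Measurable g) :
    Measurable (affinity v f g) := by
  have := measurable_likelihood v (f := fun x => (2⁻¹ : ℝ) • (f x + g x)) (by fun_prop)
  unfold affinity
  fun_prop

/-- For fixed features the midpoint density integrates to 1 over the labels, leaving exp(-‖f x - g
x‖²/(8v)); then exp(-t) ≥ 1 - t reduces the claim to the mean square distance of the regression
functions. -/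
theorem le_lintegral_affinity (S : Matrix (Fin d) (Fin d) ℝ) {v : NNReal} (hv : v ≠ 0)
    (hf : Measurable f) (hg : Measurable g) {c : ℝ} (hc : 0 ≤ c)
    (h : ∫⁻ x, ‖f x - g x‖ₑ ^ 2 ∂(multivariateGaussian 0 S) ≤ ENNReal.ofReal c) :
    ENNReal.ofReal (1 - c / (8 * v)) ≤ ∫⁻ z, affinity v f g z ∂(baseMeasure S k) := by
  have hv' : (0 : ℝ) < 8 * v := by positivity
  have hm := measurable_affinity v hf hg
  rw [baseMeasure, lintegral_prod _ hm.aemeasurable]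
  have key : ∀ x, ENNReal.ofReal (1 - ‖f x - g x‖ ^ 2 / (8 * v)) ≤
      ∫⁻ y, affinity v f g (x, y) := fun x => by
    simp only [affinity, likelihood]
    rw [lintegral_const_mul _ (by fun_prop),
      lintegral_sub_right_eq_self (isoDensity v), lintegral_isoDensity hv, mul_one]
    exact ENNReal.ofReal_le_ofReal (by linarith [Real.add_one_le_exp (-(‖f x - g x‖ ^ 2 / (8 * v)))])
  refine le_trans ?_ (lintegral_mono key)
  -- Subtraction truncates in `ℝ≥0∞`, so the negative term is moved across and a sum is integrated
  -- instead.
  rw [ENNReal.ofReal_sub _ (by positivity), tsub_le_iff_right]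
  calc ENNReal.ofReal 1 = ∫⁻ _, 1 ∂(multivariateGaussian (0 : EuclideanSpace ℝ (Fin d)) S) := by simp
    _ ≤ ∫⁻ x, (ENNReal.ofReal (1 - ‖f x - g x‖ ^ 2 / (8 * v)) +
          ENNReal.ofReal (1 / (8 * v)) * ‖f x - g x‖ₑ ^ 2) ∂(multivariateGaussian 0 S) := by
        refine lintegral_mono fun x => ?_
        rw [← ofReal_norm, ← ENNReal.ofReal_pow (norm_nonneg _),
          ← ENNReal.ofReal_mul (by positivity)]
        refine le_trans ?_ ENNReal.ofReal_add_le
        rw [← ENNReal.ofReal_one]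
        exact ENNReal.ofReal_le_ofReal (by ring_nf; rfl)
    _ = _ + ENNReal.ofReal (1 / (8 * v)) * ∫⁻ x, ‖f x - g x‖ₑ ^ 2 ∂(multivariateGaussian 0 S) := by
        rw [lintegral_add_left (by fun_prop), lintegral_const_mul _ (by fun_prop)]
    _ ≤ _ := by
        gcongr
        refine (mul_le_mul_right h _).trans ?_
        rw [← ENNReal.ofReal_mul (by positivity)]
        exact ENNReal.ofReal_le_ofReal (by ring_nf; rfl)

end DataLaw

/-! ### Assouad's method -/

/-- For r = √P √Q the gap between the two sides is exactly the sum of the two squares passed to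
`nlinarith`; the other root only helps. -/
theorem affinity_pointwise {P Q r : ℝ} (hP : 0 ≤ P) (hQ : 0 ≤ Q) (h : r ^ 2 = P * Q) (a δ : ℝ) :
    4 * δ ^ 2 * r ≤ (a - δ) ^ 2 * P + (a + δ) ^ 2 * Q + δ ^ 2 * (P + Q) := by
  have hr : r = √P * √Q ∨ r = -(√P * √Q) := by
    rw [← sq_eq_sq_iff_eq_or_eq_neg, h, mul_pow, Real.sq_sqrt hP, Real.sq_sqrt hQ]
  have h0 : 0 ≤ √P * √Q := by positivity
  have hr' : r ≤ √P * √Q := by rcases hr with h | h <;> linarith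
  have hδ : 4 * δ ^ 2 * r ≤ 4 * δ ^ 2 * (√P * √Q) := by gcongr
  have e1 := Real.sq_sqrt hP
  have e2 := Real.sq_sqrt hQ
  nlinarith [sq_nonneg ((a + δ) * √Q - δ * √P), sq_nonneg ((a - δ) * √P + δ * √Q)]

/-- Two-point lower bound for the squared error in terms of the affinity of two densities. -/
theorem two_point {Ω : Type*} [MeasurableSpace Ω] (μ : Measure Ω) {p q r : Ω → ℝ≥0∞}
    (hp : Measurable p) (hq : Measurable q) (hr : Measurable r)
    (hpt : ∀ ω, p ω ≠ ⊤) (hqt : ∀ ω, q ω ≠ ⊤) (hrpq : ∀ ω, p ω * q ω = r ω ^ 2)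
    (hp1 : ∫⁻ ω, p ω ∂μ = 1) (hq1 : ∫⁻ ω, q ω ∂μ = 1) {h : ℝ}
    (hr1 : ENNReal.ofReal (1 - h) ≤ ∫⁻ ω, r ω ∂μ) {a : Ω → ℝ} (ha : Measurable a) (δ : ℝ) :
    ENNReal.ofReal (2 * δ ^ 2 * (1 - 2 * h)) ≤
      ∫⁻ ω, ENNReal.ofReal ((a ω - δ) ^ 2) * p ω ∂μ +
        ∫⁻ ω, ENNReal.ofReal ((a ω + δ) ^ 2) * q ω ∂μ := by
  have key : ∀ ω, ENNReal.ofReal (4 * δ ^ 2) * r ω ≤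
      ENNReal.ofReal ((a ω - δ) ^ 2) * p ω + ENNReal.ofReal ((a ω + δ) ^ 2) * q ω +
        ENNReal.ofReal (δ ^ 2) * (p ω + q ω) := fun ω => by
    have hrt : r ω ≠ ⊤ := by
      intro ht
      have := hrpq ω
      rw [ht] at this
      exact ENNReal.mul_ne_top (hpt ω) (hqt ω) (by simpa using this)
    have hreal : (r ω).toReal ^ 2 = (p ω).toReal * (q ω).toReal := by
      rw [← ENNReal.toReal_mul, hrpq, ENNReal.toReal_pow]
    have := ENNReal.ofReal_le_ofReal
      (affinity_pointwise ENNReal.toReal_nonneg ENNReal.toReal_nonneg hreal (a ω) δ)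
    have hP : (0 : ℝ) ≤ (p ω).toReal := ENNReal.toReal_nonneg
    have hQ : (0 : ℝ) ≤ (q ω).toReal := ENNReal.toReal_nonneg
    rwa [ENNReal.ofReal_add (by positivity) (by positivity),
      ENNReal.ofReal_add (by positivity) (by positivity),
      ENNReal.ofReal_mul (p := 4 * δ ^ 2) (by positivity),
      ENNReal.ofReal_mul (p := (a ω - δ) ^ 2) (by positivity),
      ENNReal.ofReal_mul (p := (a ω + δ) ^ 2) (by positivity),
      ENNReal.ofReal_mul (p := δ ^ 2) (by positivity), ENNReal.ofReal_add hP hQ, ENNReal.ofReal_toReal hrt,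
      ENNReal.ofReal_toReal (hpt ω), ENNReal.ofReal_toReal (hqt ω)] at this
  have hint := lintegral_mono (μ := μ) key
  rw [lintegral_const_mul _ hr, lintegral_add_left (by fun_prop), lintegral_add_left (by fun_prop),
    lintegral_const_mul _ (by fun_prop), lintegral_add_left hp, hp1, hq1] at hint
  -- The term δ²(p + q) of the pointwise bound integrates to 2δ², which is why h appears doubled.
  rw [show 2 * δ ^ 2 * (1 - 2 * h) = 4 * δ ^ 2 * (1 - h) - 2 * δ ^ 2 by ring,
    ENNReal.ofReal_sub _ (by positivity), tsub_le_iff_right, ENNReal.ofReal_mul (by positivity)]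
  refine (mul_le_mul_right hr1 _).trans (hint.trans (le_of_eq ?_))
  rw [show (1 : ℝ≥0∞) + 1 = ENNReal.ofReal 2 by norm_num,
    ← ENNReal.ofReal_mul (by positivity), mul_comm (δ ^ 2)]

/-- The sign `±1` of a bit. -/
def bitSign (b : Bool) : ℝ := if b then 1 else -1

theorem bitSign_sq (b : Bool) : bitSign b ^ 2 = 1 := by cases b <;> simp [bitSign]

/-- Flip one coordinate of a vertex of the hypercube. -/
def flipBit {ι : Type*} [DecidableEq ι] (i : ι) (v : ι → Bool) : ι → Bool :=
  Function.update v i (!v i)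

theorem flipBit_involutive {ι : Type*} [DecidableEq ι] (i : ι) :
    Function.Involutive (flipBit i) := fun v => by simp [flipBit]

/-- For each coordinate, pair every vertex with its flip and apply `two_point`. Flipping is an
involution, so summing over all vertices counts every error twice. -/
theorem assouad {ι Ω : Type*} [Fintype ι] [DecidableEq ι] [MeasurableSpace Ω] (μ : Measure Ω)
    {p : (ι → Bool) → Ω → ℝ≥0∞} (hp : ∀ v, Measurable (p v)) (hpt : ∀ v ω, p v ω ≠ ⊤)
    (hp1 : ∀ v, ∫⁻ ω, p v ω ∂μ = 1) {h : ℝ}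
    (haff : ∀ v i, ∃ r : Ω → ℝ≥0∞, Measurable r ∧ (∀ ω, p v ω * p (flipBit i v) ω = r ω ^ 2) ∧
      ENNReal.ofReal (1 - h) ≤ ∫⁻ ω, r ω ∂μ)
    {a : ι → Ω → ℝ} (ha : ∀ i, Measurable (a i)) (δ : ℝ) :
    (Fintype.card (ι → Bool) : ℝ≥0∞) * (Fintype.card ι * ENNReal.ofReal (δ ^ 2 * (1 - 2 * h))) ≤
      ∑ v : ι → Bool, ∑ i, ∫⁻ ω, ENNReal.ofReal ((a i ω - δ * bitSign (v i)) ^ 2) * p v ω ∂μ := by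
  set e : (ι → Bool) → ι → ℝ≥0∞ := fun v i =>
    ∫⁻ ω, ENNReal.ofReal ((a i ω - δ * bitSign (v i)) ^ 2) * p v ω ∂μ with he
  have hpair : ∀ v i, ENNReal.ofReal (2 * δ ^ 2 * (1 - 2 * h)) ≤ e v i + e (flipBit i v) i := by
    intro v i
    obtain ⟨r, hr, hrp, hr1⟩ := haff v i
    have := two_point μ (hp v) (hp (flipBit i v)) hr (hpt _) (hpt _) hrp (hp1 _) (hp1 _) hr1 (ha i)
    simp only [he]
    -- The two-point bound depends on δ only through δ², so a `false` bit is handled by `-δ`.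
    cases hv : v i
    · simpa [flipBit, hv, bitSign, ← sub_eq_add_neg] using this (-δ)
    · simpa [flipBit, hv, bitSign] using this δ
  have hflip : ∀ i, ∑ v, e (flipBit i v) i = ∑ v, e v i := fun i =>
    Equiv.sum_comp (flipBit_involutive i).toPerm fun v => e v i
  have h2 : 2 * ((Fintype.card (ι → Bool) : ℝ≥0∞) *
      (Fintype.card ι * ENNReal.ofReal (δ ^ 2 * (1 - 2 * h)))) ≤ 2 * ∑ v, ∑ i, e v i := by
    calc _ = ∑ _i : ι, ∑ _v : ι → Bool, ENNReal.ofReal (2 * δ ^ 2 * (1 - 2 * h)) := by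
          rw [mul_assoc (2 : ℝ) (δ ^ 2), ENNReal.ofReal_mul zero_le_two]
          simp only [Finset.sum_const, Finset.card_univ, nsmul_eq_mul, ENNReal.ofReal_ofNat]
          ring
      _ ≤ ∑ i, ∑ v, (e v i + e (flipBit i v) i) := by gcongr; exact hpair _ _
      _ = _ := by
          simp_rw [Finset.sum_add_distrib, hflip]
          rw [Finset.sum_comm, two_mul]
  exact (ENNReal.mul_le_mul_iff_right (by simp) (by simp)).1 h2

/-! ### Bernoulli-type bounds for affinities -/

theorem ofReal_one_sub_add_le_mul {X Y : ℝ≥0∞} {a b : ℝ} (ha : 0 ≤ a) (hb : 0 ≤ b)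
    (hX : ENNReal.ofReal (1 - a) ≤ X) (hY : ENNReal.ofReal (1 - b) ≤ Y) :
    ENNReal.ofReal (1 - (a + b)) ≤ X * Y := by
  rcases le_total (1 - (a + b)) 0 with h | h
  · simp [ENNReal.ofReal_of_nonpos h]
  · refine le_trans ?_ (mul_le_mul' hX hY)
    rw [← ENNReal.ofReal_mul (by linarith)]
    exact ENNReal.ofReal_le_ofReal (by nlinarith [mul_nonneg ha hb])

theorem ofReal_one_sub_mul_le_pow {X : ℝ≥0∞} {a : ℝ} (ha : 0 ≤ a)
    (hX : ENNReal.ofReal (1 - a) ≤ X) (n : ℕ) : ENNReal.ofReal (1 - n * a) ≤ X ^ n := by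
  induction n with
  | zero => simp
  | succ n ih =>
    rw [pow_succ]
    convert ofReal_one_sub_add_le_mul (by positivity) ha ih hX using 3
    push_cast; ring

/-! ### Samples -/

section Sample

variable {d k nS nT : ℕ}

/-- Measure dominating the joint law of the two samples. -/
noncomputable def sampleBase (covS covT : Matrix (Fin d) (Fin d) ℝ) (k nS nT : ℕ) :
    Measure ((Fin nS → Example d k) × (Fin nT → Example d k)) :=
  (Measure.pi fun _ => baseMeasure covS k).prod (Measure.pi fun _ => baseMeasure covT k)

/-- A product over the two samples. -/
noncomputable def sampleProd (F G : Example d k → ℝ≥0∞)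
    (s : (Fin nS → Example d k) × (Fin nT → Example d k)) : ℝ≥0∞ :=
  (∏ j, F (s.1 j)) * ∏ j, G (s.2 j)

theorem measurable_sampleProd {F G : Example d k → ℝ≥0∞} (hF : Measurable F) (hG : Measurable G) :
    Measurable (sampleProd (nS := nS) (nT := nT) F G) := by
  unfold sampleProd
  fun_prop

theorem lintegral_sampleProd (covS covT : Matrix (Fin d) (Fin d) ℝ)
    {F G : Example d k → ℝ≥0∞} (hF : Measurable F) (hG : Measurable G) :
    ∫⁻ s, sampleProd F G s ∂(sampleBase covS covT k nS nT) =
      (∫⁻ z, F z ∂(baseMeasure covS k)) ^ nS * (∫⁻ z, G z ∂(baseMeasure covT k)) ^ nT := by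
  simp only [sampleProd, sampleBase]
  rw [lintegral_prod_mul (f := fun s : Fin nS → Example d k => ∏ j, F (s j))
    (g := fun s : Fin nT → Example d k => ∏ j, G (s j)) (Measurable.aemeasurable (by fun_prop))
    (Measurable.aemeasurable (by fun_prop)),
    lintegral_pi_prod _ hF, lintegral_pi_prod _ hG]

/-- Change of measure: all vertices of the hypercube are compared under one base measure, as
`assouad` requires. -/
theorem lintegral_sample (covS covT : Matrix (Fin d) (Fin d) ℝ) {v : NNReal} (hv : v ≠ 0) {σ : ℝ}
    (hσ : σ ^ 2 = v) {fS fT : EuclideanSpace ℝ (Fin d) → EuclideanSpace ℝ (Fin k)}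
    (hfS : Measurable fS) (hfT : Measurable fT)
    {F : (Fin nS → Example d k) × (Fin nT → Example d k) → ℝ≥0∞} (hF : Measurable F) :
    ∫⁻ s, ∫⁻ t, F (s, t) ∂(Measure.pi fun _ => dataLaw covT σ fT)
        ∂(Measure.pi fun _ => dataLaw covS σ fS) =
      ∫⁻ s, F s * sampleProd (likelihood v fS) (likelihood v fT) s
        ∂(sampleBase covS covT k nS nT) := by
  have hpS := isProbabilityMeasure_dataLaw covS σ hfS
  have hpT := isProbabilityMeasure_dataLaw covT σ hfT
  have hlS := measurable_likelihood v hfS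
  have hlT := measurable_likelihood v hfT
  rw [← lintegral_prod _ hF.aemeasurable]
  rw [dataLaw_eq_withDensity covS hv hσ hfS] at hpS ⊢
  rw [dataLaw_eq_withDensity covT hv hσ hfT] at hpT ⊢
  rw [pi_withDensity _ hlS, pi_withDensity _ hlT, prod_withDensity (by fun_prop) (by fun_prop),
    lintegral_withDensity_eq_lintegral_mul _ (by fun_prop) hF]
  refine lintegral_congr fun s => ?_
  simp [sampleProd, mul_comm]

end Sample

/-! ### Linear algebra of the transfer distance -/

section LinearAlgebra

variable {n p : ℕ} {A : Matrix (Fin n) (Fin n) ℝ}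

theorem cfc_mulVec_eigenvectorBasis (hA : A.IsHermitian) (φ : ℝ → ℝ) (i : Fin n) :
    cfc φ A *ᵥ (hA.eigenvectorBasis i).ofLp =
      φ (hA.eigenvalues i) • (hA.eigenvectorBasis i).ofLp := by
  rw [hA.cfc_eq, Matrix.IsHermitian.cfc, Unitary.conjStarAlgAut_apply, ← Matrix.mulVec_mulVec,
    ← Matrix.mulVec_mulVec, hA.star_eigenvectorUnitary_mulVec, Matrix.diagonal_mulVec_single]
  simp only [mul_one, Function.comp_apply, RCLike.ofReal_real_eq_id, id]
  rw [show Pi.single i (φ (hA.eigenvalues i)) =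
      φ (hA.eigenvalues i) • (Pi.single i 1 : Fin n → ℝ) by rw [← Pi.single_smul]; simp,
    Matrix.mulVec_smul, hA.eigenvectorUnitary_mulVec]

theorem sqrt_mulVec_eigenvectorBasis (hA : A.PosSemidef) (i : Fin n) :
    CFC.sqrt A *ᵥ (hA.1.eigenvectorBasis i).ofLp =
      √(hA.1.eigenvalues i) • (hA.1.eigenvectorBasis i).ofLp := by
  rw [CFC.sqrt_eq_real_sqrt A hA.nonneg, cfcₙ_eq_cfc]
  exact cfc_mulVec_eigenvectorBasis hA.1 _ i

theorem transpose_sqrt (A : Matrix (Fin n) (Fin n) ℝ) : (CFC.sqrt A)ᵀ = CFC.sqrt A := by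
  have := (CFC.sqrt_nonneg A).isSelfAdjoint.star_eq
  rwa [Matrix.star_eq_conjTranspose, Matrix.conjTranspose_eq_transpose_of_trivial] at this

theorem sq_frobNorm {m : ℕ} (B : Matrix (Fin m) (Fin n) ℝ) :
    frobNorm B ^ 2 = ∑ i, ∑ j, B i j ^ 2 :=
  Real.sq_sqrt (Finset.sum_nonneg fun _ _ => Finset.sum_nonneg fun _ _ => sq_nonneg _)

theorem sq_transferDist (A : Matrix (Fin n) (Fin n) ℝ) (M₁ M₂ : Matrix (Fin p) (Fin n) ℝ) :
    transferDist A M₁ M₂ ^ 2 = ∑ j, ∑ i, (CFC.sqrt A *ᵥ (M₁ - M₂) j) i ^ 2 := by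
  rw [transferDist, sq_frobNorm, Finset.sum_comm]
  rfl

theorem sq_transferDist_eq_quadratic (hA : A.PosSemidef) (M₁ M₂ : Matrix (Fin p) (Fin n) ℝ) :
    transferDist A M₁ M₂ ^ 2 = ∑ j, (M₁ - M₂) j ⬝ᵥ A *ᵥ (M₁ - M₂) j := by
  rw [sq_transferDist]
  refine Finset.sum_congr rfl fun j _ => ?_
  conv_rhs => rw [← CFC.sqrt_mul_sqrt_self A hA.nonneg]
  rw [← Matrix.mulVec_mulVec, Matrix.dotProduct_mulVec, ← Matrix.mulVec_transpose, transpose_sqrt]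
  simp [dotProduct, sq]

theorem sq_transferDist_eq_spectral (hA : A.PosSemidef) (M₁ M₂ : Matrix (Fin p) (Fin n) ℝ) :
    transferDist A M₁ M₂ ^ 2 =
      ∑ j, ∑ i, (√(hA.1.eigenvalues i) *
        ((hA.1.eigenvectorBasis i).ofLp ⬝ᵥ (M₁ - M₂) j)) ^ 2 := by
  rw [sq_transferDist]
  refine Finset.sum_congr rfl fun j _ => ?_
  have := hA.1.eigenvectorBasis.sum_sq_inner_right (WithLp.toLp 2 (CFC.sqrt A *ᵥ (M₁ - M₂) j))
  rw [EuclideanSpace.real_norm_sq_eq] at this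
  rw [← this]
  refine Finset.sum_congr rfl fun i _ => ?_
  congr 1
  rw [EuclideanSpace.inner_eq_star_dotProduct, star_trivial, dotProduct_comm,
    Matrix.dotProduct_mulVec, ← Matrix.mulVec_transpose, transpose_sqrt,
    sqrt_mulVec_eigenvectorBasis hA, smul_dotProduct, smul_eq_mul]

theorem sum_sq_mulVec_le {m : ℕ} (B : Matrix (Fin m) (Fin n) ℝ) (x : Fin n → ℝ) :
    ∑ i, (B *ᵥ x) i ^ 2 ≤ opNorm B ^ 2 * ∑ i, x i ^ 2 := by
  have := (LinearMap.toContinuousLinearMap (Matrix.toEuclideanLin B)).le_opNorm (WithLp.toLp 2 x)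
  have h2 := pow_le_pow_left₀ (norm_nonneg _) this 2
  rw [mul_pow, EuclideanSpace.real_norm_sq_eq, EuclideanSpace.real_norm_sq_eq] at h2
  exact h2

/-- Whitened coordinates: `Φ` embeds a Euclidean space of dimension `rank A * p` into the
`p × n` matrices, isometrically for the transfer distance. -/
theorem exists_whitened_coordinates (hA : A.PosSemidef) (p : ℕ) :
    ∃ (ι : Type) (_ : Fintype ι) (_ : DecidableEq ι) (Φ : (ι → ℝ) → Matrix (Fin p) (Fin n) ℝ)
      (row : ι → Fin p) (K : ι → Fin n → ℝ),
      (Fintype.card ι : ℝ) = effDim A p + 1 ∧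
      (∀ M c, ∑ i, (K i ⬝ᵥ M (row i) - c i) ^ 2 ≤ transferDist A M (Φ c) ^ 2) ∧
      (∀ c c', transferDist A (Φ c) (Φ c') ^ 2 ≤ ∑ i, (c i - c' i) ^ 2) ∧
      (∀ B c c', transferDist B (Φ c) (Φ c') ^ 2 ≤
        covRatio B A * ∑ i, (c i - c' i) ^ 2) := by
  set u := hA.1.eigenvectorBasis with hu
  set lam := hA.1.eigenvalues with hlam
  -- Directions in the kernel of `A` are invisible to the transfer distance; the remaining
  -- eigenvectors number `A.rank`.
  let J := {i // lam i ≠ 0}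
  let ext : (Fin p × J → ℝ) → Fin p → Fin n → ℝ := fun c j i =>
    if h : lam i ≠ 0 then c (j, ⟨i, h⟩) else 0
  have ext_J : ∀ c j (i : J), ext c j i = c (j, i) := fun c j i => by simp [ext, i.2]
  have ext_sub : ∀ c c' j i, ext (c - c') j i = ext c j i - ext c' j i := fun c c' j i => by
    simp only [ext]; split_ifs <;> simp
  have sum_ext : ∀ c, ∑ j, ∑ i, ext c j i ^ 2 = ∑ i, c i ^ 2 := fun c => by
    rw [Fintype.sum_prod_type]
    refine Finset.sum_congr rfl fun j _ => ?_
    rw [← Fintype.sum_subtype_add_sum_subtype (fun i => lam i ≠ 0)]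
    have h0 : ∑ i : {i // ¬ lam i ≠ 0}, ext c j i ^ 2 = 0 :=
      Finset.sum_eq_zero fun i _ => by simp [ext, not_not.1 i.2]
    rw [h0, add_zero]
    exact Finset.sum_congr rfl fun i _ => by rw [ext_J]
  let x : (Fin p × J → ℝ) → Fin p → EuclideanSpace ℝ (Fin n) := fun c j => ∑ i, ext c j i • u i
  have inner_x : ∀ c j i, inner ℝ (u i) (x c j) = ext c j i := fun c j i => by
    simp [x, inner_sum, inner_smul_right, orthonormal_iff_ite.1 u.orthonormal]
  -- Each row is A^{-1/2} applied to a vector with orthonormal coordinates `c`. Measuring with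
  -- another covariance `B` therefore applies B^{1/2} A^{-1/2}, whose squared norm is `covRatio B
  -- A`.
  let Φ : (Fin p × J → ℝ) → Matrix (Fin p) (Fin n) ℝ := fun c =>
    Matrix.of fun j => invSqrt A *ᵥ (x c j).ofLp
  have hsub : ∀ c c' j, (Φ c - Φ c') j = invSqrt A *ᵥ (x (c - c') j).ofLp := by
    intro c c' j
    have : x (c - c') j = x c j - x c' j := by
      simp [x, ext_sub, sub_smul, Finset.sum_sub_distrib]
    rw [this, WithLp.ofLp_sub, Matrix.mulVec_sub]
    rfl
  have hnorm : ∀ c, ∑ j, ∑ i, (x c j).ofLp i ^ 2 = ∑ i, c i ^ 2 := by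
    intro c
    rw [← sum_ext]
    refine Finset.sum_congr rfl fun j _ => ?_
    rw [← EuclideanSpace.real_norm_sq_eq, ← u.sum_sq_inner_right]
    simp_rw [inner_x]
  have hΦ : ∀ c j (i : Fin n), (u i).ofLp ⬝ᵥ Φ c j = (√(lam i))⁻¹ * ext c j i := by
    intro c j i
    have h1 : Φ c j = ∑ i, (ext c j i * (√(lam i))⁻¹) • (u i).ofLp := by
      change invSqrt A *ᵥ (x c j).ofLp = _
      simp only [x, WithLp.ofLp_sum, WithLp.ofLp_smul, Matrix.mulVec_sum, Matrix.mulVec_smul]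
      refine Finset.sum_congr rfl fun i _ => ?_
      rw [invSqrt, cfc_mulVec_eigenvectorBasis hA.1, smul_smul]
    have h2 : Φ c j = (∑ i, (ext c j i * (√(lam i))⁻¹) • u i : EuclideanSpace ℝ (Fin n)).ofLp := by
      rw [h1]; simp
    rw [h2, dotProduct_comm, ← star_trivial (u i).ofLp, ← EuclideanSpace.inner_eq_star_dotProduct]
    simp [inner_sum, inner_smul_right, orthonormal_iff_ite.1 u.orthonormal, mul_comm]
  -- The functional √λ u reads a whitened coordinate off any matrix, so estimates outside the range
  -- of `Φ` are covered too.
  refine ⟨Fin p × J, inferInstance, inferInstance, Φ, Prod.fst,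
    fun i => √(lam i.2) • (u i.2).ofLp, ?_, ?_, ?_, ?_⟩
  · rw [effDim, hA.1.rank_eq_card_non_zero_eigs]
    simp [J, hlam, mul_comm]
  · intro M c
    rw [sq_transferDist_eq_spectral hA, Fintype.sum_prod_type]
    refine Finset.sum_le_sum fun j _ => ?_
    rw [← Fintype.sum_subtype_add_sum_subtype (fun i => lam i ≠ 0)]
    refine le_add_of_le_of_nonneg (le_of_eq (Finset.sum_congr rfl fun i _ => ?_))
      (Finset.sum_nonneg fun _ _ => sq_nonneg _)
    have hpos : √(lam i) ≠ 0 :=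
      (Real.sqrt_pos.2 (lt_of_le_of_ne (hA.eigenvalues_nonneg i) (Ne.symm i.2))).ne'
    have : (M - Φ c) j = M j - Φ c j := rfl
    rw [this, dotProduct_sub, hΦ, ext_J, mul_sub, mul_inv_cancel_left₀ hpos, smul_dotProduct,
      smul_eq_mul]
  · intro c c'
    have := sum_ext (c - c')
    simp only [Pi.sub_apply] at this
    rw [sq_transferDist_eq_spectral hA, ← this]
    refine Finset.sum_le_sum fun j _ => Finset.sum_le_sum fun i _ => ?_
    have h1 : (Φ c - Φ c') j = Φ c j - Φ c' j := rfl
    rw [h1, dotProduct_sub, hΦ, hΦ, ext_sub, ← mul_sub]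
    rcases eq_or_ne (√(lam i)) 0 with h | h
    · rw [← hlam, h]; simpa using sq_nonneg _
    · rw [mul_inv_cancel_left₀ h]
  · intro B c c'
    rw [sq_transferDist, covRatio]
    have := hnorm (c - c')
    simp only [Pi.sub_apply] at this
    rw [← this, Finset.mul_sum]
    refine Finset.sum_le_sum fun j _ => ?_
    rw [hsub, Matrix.mulVec_mulVec]
    exact sum_sq_mulVec_le _ _

end LinearAlgebra

/-! ### Second moments -/

/-- For models linear in the parameter this identifies the prediction distance with the transfer
distance: `ψ` is the identity for the linear model (and for the noise), the hidden layer for the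
fixed input layer. -/
theorem lintegral_enorm_sq_toEuclideanLin {Ω : Type*} [MeasurableSpace Ω] {μ : Measure Ω}
    {n p : ℕ} {ψ : Ω → EuclideanSpace ℝ (Fin n)} (hψ : ∀ i, MemLp (fun ω => ψ ω i) 2 μ)
    {A : Matrix (Fin n) (Fin n) ℝ} (hA : ∀ i j, ∫ ω, ψ ω i * ψ ω j ∂μ = A i j)
    (M : Matrix (Fin p) (Fin n) ℝ) :
    ∫⁻ ω, ‖Matrix.toEuclideanLin M (ψ ω)‖ₑ ^ 2 ∂μ = ENNReal.ofReal (∑ j, M j ⬝ᵥ A *ᵥ M j) := by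
  have hint : ∀ i j, Integrable (fun ω => ψ ω i * ψ ω j) μ := fun i j => (hψ i).integrable_mul (hψ j)
  have hexp : ∀ ω, ‖Matrix.toEuclideanLin M (ψ ω)‖ ^ 2 =
      ∑ j, ∑ i, ∑ i', M j i * M j i' * (ψ ω i * ψ ω i') := fun ω => by
    rw [EuclideanSpace.real_norm_sq_eq]
    refine Finset.sum_congr rfl fun j _ => ?_
    change (∑ i, M j i * ψ ω i) ^ 2 = _
    rw [sq, Finset.sum_mul_sum]
    exact Finset.sum_congr rfl fun i _ => Finset.sum_congr rfl fun i' _ => by ring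
  have hI : ∀ j i i', Integrable (fun ω => M j i * M j i' * (ψ ω i * ψ ω i')) μ :=
    fun j i i' => (hint i i').const_mul _
  have h1 : Integrable (fun ω => ‖Matrix.toEuclideanLin M (ψ ω)‖ ^ 2) μ := by
    simp_rw [hexp]
    exact integrable_finsetSum _ fun j _ => integrable_finsetSum _ fun i _ =>
      integrable_finsetSum _ fun i' _ => hI j i i'
  have h2 : ∫ ω, ‖Matrix.toEuclideanLin M (ψ ω)‖ ^ 2 ∂μ = ∑ j, M j ⬝ᵥ A *ᵥ M j := by
    simp_rw [hexp]
    rw [integral_finsetSum _ fun j _ => integrable_finsetSum _ fun i _ =>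
      integrable_finsetSum _ fun i' _ => hI j i i']
    refine Finset.sum_congr rfl fun j _ => ?_
    rw [integral_finsetSum _ fun i _ => integrable_finsetSum _ fun i' _ => hI j i i']
    simp only [dotProduct, Matrix.mulVec, Finset.mul_sum]
    refine Finset.sum_congr rfl fun i _ => ?_
    rw [integral_finsetSum _ fun i' _ => hI j i i']
    refine Finset.sum_congr rfl fun i' _ => ?_
    rw [integral_const_mul, hA]
    ring
  rw [← h2, ofReal_integral_eq_lintegral_ofReal h1 (ae_of_all _ fun _ => sq_nonneg _)]
  refine lintegral_congr fun ω => ?_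
  rw [ENNReal.ofReal_pow (norm_nonneg _), ofReal_norm]

/-- Gives positivity of `reluCov`, which is not evident from its closed formula. -/
theorem posSemidef_of_secondMoment {Ω : Type*} [MeasurableSpace Ω] {μ : Measure Ω}
    {n : ℕ} {ψ : Ω → EuclideanSpace ℝ (Fin n)} (hψ : ∀ i, MemLp (fun ω => ψ ω i) 2 μ)
    {A : Matrix (Fin n) (Fin n) ℝ} (hA : ∀ i j, ∫ ω, ψ ω i * ψ ω j ∂μ = A i j) :
    A.PosSemidef := by
  have hint : ∀ i j, Integrable (fun ω => ψ ω i * ψ ω j) μ := fun i j => (hψ i).integrable_mul (hψ j)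
  refine Matrix.PosSemidef.of_dotProduct_mulVec_nonneg ?_ fun x => ?_
  · ext i j
    simp [← hA, mul_comm]
  · have : star x ⬝ᵥ A *ᵥ x = ∫ ω, (∑ i, x i * ψ ω i) ^ 2 ∂μ := by
      have hexp : ∀ ω, (∑ i, x i * ψ ω i) ^ 2 = ∑ i, ∑ j, x i * x j * (ψ ω i * ψ ω j) := fun ω => by
        rw [sq, Finset.sum_mul_sum]
        exact Finset.sum_congr rfl fun i _ => Finset.sum_congr rfl fun i' _ => by ring
      simp_rw [hexp]
      rw [integral_finsetSum _ fun i _ => integrable_finsetSum _ fun j _ => (hint i j).const_mul _]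
      simp only [star_trivial, dotProduct, Matrix.mulVec, Finset.mul_sum]
      refine Finset.sum_congr rfl fun i _ => ?_
      rw [integral_finsetSum _ fun j _ => (hint i j).const_mul _]
      refine Finset.sum_congr rfl fun j _ => ?_
      rw [integral_const_mul, hA]
      ring
    rw [this]
    exact integral_nonneg fun _ => sq_nonneg _

section Gaussian

variable {d : ℕ} {S : Matrix (Fin d) (Fin d) ℝ}

theorem memLp_eval_multivariateGaussian (S : Matrix (Fin d) (Fin d) ℝ) (i : Fin d) :
    MemLp (fun x : EuclideanSpace ℝ (Fin d) => x i) 2 (multivariateGaussian 0 S) :=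
  (EuclideanSpace.proj (𝕜 := ℝ) i).comp_memLp' IsGaussian.memLp_two_id

theorem integral_eval_mul_eval_multivariateGaussian (hS : S.PosSemidef) (i j : Fin d) :
    ∫ x : EuclideanSpace ℝ (Fin d), x i * x j ∂(multivariateGaussian 0 S) = S i j := by
  have h0 : ∀ i, ∫ x : EuclideanSpace ℝ (Fin d), x i ∂(multivariateGaussian 0 S) = 0 := fun i => by
    have := (EuclideanSpace.proj (𝕜 := ℝ) i).integral_comp_comm
      (IsGaussian.integrable_id (μ := multivariateGaussian 0 S))
    simpa using this
  rw [← covariance_eval_multivariateGaussian (μ := 0) hS i j,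
    covariance_eq_sub (memLp_eval_multivariateGaussian S i) (memLp_eval_multivariateGaussian S j)]
  simp [h0]

theorem map_neg_multivariateGaussian (hS : S.PosSemidef) :
    (multivariateGaussian 0 S).map (fun x => -x) = multivariateGaussian 0 S := by
  apply Measure.ext_of_charFun
  ext t
  have : (fun x : EuclideanSpace ℝ (Fin d) => -x) = fun x => (-1 : ℝ) • x := by ext; simp
  rw [this, charFun_map_smul, charFun_multivariateGaussian hS, charFun_multivariateGaussian hS]
  simp [Matrix.mulVec_neg]

theorem lintegral_comp_neg_multivariateGaussian (hS : S.PosSemidef)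
    {F : EuclideanSpace ℝ (Fin d) → ℝ≥0∞} (hF : Measurable F) :
    ∫⁻ x, F (-x) ∂(multivariateGaussian 0 S) = ∫⁻ x, F x ∂(multivariateGaussian 0 S) := by
  conv_rhs => rw [← map_neg_multivariateGaussian hS, lintegral_map hF (by fun_prop)]

/-- The noise is symmetric, so averaging over w and -w and using the parallelogram law removes the
cross term without leaving `ℝ≥0∞`. -/
theorem lintegral_enorm_add_sq_multivariateGaussian {k : ℕ} (σ : ℝ)
    (u : EuclideanSpace ℝ (Fin k)) :
    ∫⁻ w, ‖u + w‖ₑ ^ 2 ∂(multivariateGaussian 0 (σ ^ 2 • (1 : Matrix (Fin k) (Fin k) ℝ))) =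
      ‖u‖ₑ ^ 2 + ENNReal.ofReal (k * σ ^ 2) := by
  have hps : (σ ^ 2 • (1 : Matrix (Fin k) (Fin k) ℝ)).PosSemidef :=
    Matrix.PosSemidef.one.smul (sq_nonneg σ)
  set N := multivariateGaussian 0 (σ ^ 2 • (1 : Matrix (Fin k) (Fin k) ℝ))
  have hw : ∫⁻ w, ‖w‖ₑ ^ 2 ∂N = ENNReal.ofReal (k * σ ^ 2) := by
    have := lintegral_enorm_sq_toEuclideanLin (ψ := id) (memLp_eval_multivariateGaussian _)
      (integral_eval_mul_eval_multivariateGaussian hps) (1 : Matrix (Fin k) (Fin k) ℝ)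
    have h1 : ∑ j, (1 : Matrix (Fin k) (Fin k) ℝ) j ⬝ᵥ
        (σ ^ 2 • (1 : Matrix (Fin k) (Fin k) ℝ)) *ᵥ (1 : Matrix (Fin k) (Fin k) ℝ) j =
        k * σ ^ 2 := by
      simp [Matrix.smul_mulVec, dotProduct, Matrix.one_apply]
    rw [h1] at this
    simpa using this
  have hpar : ∀ w : EuclideanSpace ℝ (Fin k),
      ‖u + w‖ₑ ^ 2 + ‖u + -w‖ₑ ^ 2 = 2 * ‖u‖ₑ ^ 2 + 2 * ‖w‖ₑ ^ 2 := fun w => by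
    have := parallelogram_law_with_norm ℝ u w
    simp only [← ofReal_norm, ← sub_eq_add_neg]
    simp only [← ENNReal.ofReal_pow (norm_nonneg _)]
    rw [two_mul, two_mul]
    simp only [← ENNReal.ofReal_add (sq_nonneg _) (sq_nonneg _)]
    rw [← ENNReal.ofReal_add (by positivity) (by positivity)]
    congr 1
    linarith
  have hsymm : ∫⁻ w, ‖u + -w‖ₑ ^ 2 ∂N = ∫⁻ w, ‖u + w‖ₑ ^ 2 ∂N :=
    lintegral_comp_neg_multivariateGaussian hps (F := fun w => ‖u + w‖ₑ ^ 2) (by fun_prop)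
  have h2 : 2 * ∫⁻ w, ‖u + w‖ₑ ^ 2 ∂N = 2 * (‖u‖ₑ ^ 2 + ENNReal.ofReal (k * σ ^ 2)) := by
    conv_lhs => rw [two_mul]
    nth_rewrite 2 [← hsymm]
    rw [← lintegral_add_left (by fun_prop)]
    simp_rw [hpar]
    rw [lintegral_add_left (by fun_prop), lintegral_const, lintegral_const_mul _ (by fun_prop), hw]
    simp [mul_add]
  exact (ENNReal.mul_right_inj (by simp) (by simp)).1 h2

end Gaussian

theorem genError_dataLaw {d k p q : ℕ} (S : Matrix (Fin d) (Fin d) ℝ) (σ : ℝ)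
    {f : Matrix (Fin p) (Fin q) ℝ → EuclideanSpace ℝ (Fin d) → EuclideanSpace ℝ (Fin k)}
    (hf : ∀ θ, Measurable (f θ)) (θ θ' : Matrix (Fin p) (Fin q) ℝ) :
    genError f (dataLaw S σ (f θ)) θ' =
      ∫⁻ x, ‖f θ x - f θ' x‖ₑ ^ 2 ∂(multivariateGaussian 0 S) + ENNReal.ofReal (k * σ ^ 2) := by
  have h1 := hf θ
  have h2 := hf θ'
  rw [genError, lintegral_dataLaw S σ h1 (F := fun z => ‖z.2 - f θ' z.1‖ₑ ^ 2) (by fun_prop)]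
  have : ∀ x w, f θ x + w - f θ' x = (f θ x - f θ' x) + w := fun x w => by abel
  simp_rw [this, lintegral_enorm_add_sq_multivariateGaussian]
  rw [lintegral_add_left (by fun_prop)]
  simp

/-! ### The minimax bound for a general regression model -/

theorem sum_sq_flipBit {ι : Type*} [Fintype ι] [DecidableEq ι] (t : ℝ) (v : ι → Bool) (i : ι) :
    ∑ j, (t * bitSign (v j) - t * bitSign (flipBit i v j)) ^ 2 = 4 * t ^ 2 := by
  rw [Finset.sum_eq_single i]
  · cases hv : v i <;> simp [flipBit, hv, bitSign] <;> ring
  · intro j _ hj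
    simp [flipBit, Function.update_of_ne hj]
  · simp

section General

variable {d k p n : ℕ} {covS covT : Matrix (Fin d) (Fin d) ℝ} {AS AT : Matrix (Fin n) (Fin n) ℝ}
  {f : Matrix (Fin p) (Fin n) ℝ → EuclideanSpace ℝ (Fin d) → EuclideanSpace ℝ (Fin k)} {s c : ℝ}

/-- The supremum dominates the average over the hypercube, to which Assouad's bound applies. The
parameter τ sets how strongly the source follows the target signs; δ is the half side length of the
target cube. -/
theorem hypercube_le_minimaxRisk {σ : ℝ} (hσ : 0 < σ)
    (hAT : AT.PosSemidef) (hf : ∀ θ, Measurable (f θ)) (hs : 0 ≤ s) (hc : 0 ≤ c)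
    (hUS : ∀ M M', ∫⁻ x, ‖f M x - f M' x‖ₑ ^ 2 ∂(multivariateGaussian 0 covS) ≤
      ENNReal.ofReal (s * transferDist AS M M' ^ 2))
    (hUT : ∀ M M', ∫⁻ x, ‖f M x - f M' x‖ₑ ^ 2 ∂(multivariateGaussian 0 covT) ≤
      ENNReal.ofReal (s * transferDist AT M M' ^ 2))
    (hL : ∀ M M', ENNReal.ofReal (c * transferDist AT M M' ^ 2) ≤
      ∫⁻ x, ‖f M x - f M' x‖ₑ ^ 2 ∂(multivariateGaussian 0 covT))
    (nS nT : ℕ) {Δ : ℝ} (hΔ : 0 ≤ Δ) {τ δ : ℝ}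
    (hτδ : (1 - τ) ^ 2 * δ ^ 2 * (effDim AT p + 1) ≤ Δ ^ 2) :
    ENNReal.ofReal (c * ((effDim AT p + 1) * (δ ^ 2 *
        (1 - (τ ^ 2 * (covRatio AS AT * s * nS) + s * nT) * δ ^ 2 / σ ^ 2))) + k * σ ^ 2) ≤
      minimaxRisk covS covT σ f (transferDist AT) nS nT Δ := by
  obtain ⟨ι, _, _, Φ, row, K, hcard, hlow, hup, hcov⟩ := exists_whitened_coordinates hAT p
  have hr : 0 ≤ covRatio AS AT := sq_nonneg _
  set v : NNReal := ⟨σ ^ 2, sq_nonneg σ⟩ with hv_def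
  have hvσ : σ ^ 2 = v := rfl
  have hv : v ≠ 0 := by
    intro h
    exact (pow_pos hσ 2).ne' (by rw [hvσ, h]; rfl)
  rw [minimaxRisk]
  refine le_iInf fun ⟨est, hest⟩ => ?_
  set R := ⨆ PQ ∈ pairClass covS covT σ f (transferDist AT) Δ,
      ∫⁻ s, ∫⁻ t, genError f PQ.2 (est s t)
        ∂(Measure.pi fun _ : Fin nT => PQ.2) ∂(Measure.pi fun _ : Fin nS => PQ.1) with hR
  let θT : (ι → Bool) → Matrix (Fin p) (Fin n) ℝ := fun b => Φ fun i => δ * bitSign (b i)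
  let θS : (ι → Bool) → Matrix (Fin p) (Fin n) ℝ := fun b => Φ fun i => τ * δ * bitSign (b i)
  let dens : (ι → Bool) → (Fin nS → Example d k) × (Fin nT → Example d k) → ℝ≥0∞ := fun b =>
    sampleProd (likelihood v (f (θS b))) (likelihood v (f (θT b)))
  let μ := sampleBase covS covT k nS nT
  let a : ι → (Fin nS → Example d k) × (Fin nT → Example d k) → ℝ := fun i st =>
    K i ⬝ᵥ est st.1 st.2 (row i)
  have ha : ∀ i, Measurable (a i) := fun i => by
    simp only [a, dotProduct]
    exact Finset.measurable_sum _ fun j _ => (hest (row i) j).const_mul _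
  have hdens : ∀ b, Measurable (dens b) := fun b =>
    measurable_sampleProd (measurable_likelihood v (hf _)) (measurable_likelihood v (hf _))
  -- Affinity loss per example: neighbouring vertices differ by 2τδ (source) or 2δ (target) in one
  -- coordinate, and 8v comes from `le_lintegral_affinity`.
  set aS : ℝ := s * (covRatio AS AT * (4 * (τ * δ) ^ 2)) / (8 * v) with haS
  set aT : ℝ := s * (4 * δ ^ 2) / (8 * v) with haT
  have haS0 : 0 ≤ aS := by positivity
  have haT0 : 0 ≤ aT := by positivity
  have hass := assouad μ hdens (h := nS * aS + nT * aT)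
    (fun b ω => ENNReal.mul_ne_top
      (ENNReal.prod_ne_top fun _ _ => isoDensity_ne_top _ _)
      (ENNReal.prod_ne_top fun _ _ => isoDensity_ne_top _ _))
    (fun b => by
      rw [lintegral_sampleProd covS covT (measurable_likelihood v (hf _))
        (measurable_likelihood v (hf _)), lintegral_likelihood covS hv (hf _),
        lintegral_likelihood covT hv (hf _)]
      simp)
    (fun b i => by
      have mS := measurable_affinity v (hf (θS b)) (hf (θS (flipBit i b)))
      have mT := measurable_affinity v (hf (θT b)) (hf (θT (flipBit i b)))
      refine ⟨sampleProd (affinity v (f (θS b)) (f (θS (flipBit i b))))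
        (affinity v (f (θT b)) (f (θT (flipBit i b)))), measurable_sampleProd mS mT, ?_, ?_⟩
      · intro ω
        simp only [dens, sampleProd]
        rw [mul_mul_mul_comm, ← Finset.prod_mul_distrib, ← Finset.prod_mul_distrib, mul_pow,
          ← Finset.prod_pow, ← Finset.prod_pow]
        simp_rw [likelihood_mul_likelihood]
      · rw [lintegral_sampleProd covS covT mS mT]
        refine ofReal_one_sub_add_le_mul (by positivity) (by positivity)
          (ofReal_one_sub_mul_le_pow haS0 ?_ _) (ofReal_one_sub_mul_le_pow haT0 ?_ _)
        · refine le_lintegral_affinity covS hv (hf _) (hf _) (by positivity) ((hUS _ _).trans ?_)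
          refine ENNReal.ofReal_le_ofReal (mul_le_mul_of_nonneg_left ((hcov _ _ _).trans ?_) hs)
          rw [sum_sq_flipBit]
        · refine le_lintegral_affinity covT hv (hf _) (hf _) (by positivity) ((hUT _ _).trans ?_)
          refine ENNReal.ofReal_le_ofReal (mul_le_mul_of_nonneg_left ((hup _ _).trans ?_) hs)
          rw [sum_sq_flipBit])
    ha δ
  have hmem : ∀ b, (dataLaw covS σ (f (θS b)), dataLaw covT σ (f (θT b))) ∈
      pairClass covS covT σ f (transferDist AT) Δ := fun b => by
    refine ⟨θS b, θT b, ?_, rfl, rfl⟩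
    refine (abs_le_of_sq_le_sq' (le_trans (hup _ _) ?_) hΔ).2
    have : ∀ i, (τ * δ * bitSign (b i) - δ * bitSign (b i)) ^ 2 = (1 - τ) ^ 2 * δ ^ 2 := fun i => by
      linear_combination (1 - τ) ^ 2 * δ ^ 2 * bitSign_sq (b i)
    simp_rw [this]
    rw [Finset.sum_const, Finset.card_univ, nsmul_eq_mul, hcard]
    linarith
  have hrisk : ∀ b, ENNReal.ofReal c *
      ∑ i, ∫⁻ ω, ENNReal.ofReal ((a i ω - δ * bitSign (b i)) ^ 2) * dens b ω ∂μ +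
        ENNReal.ofReal (k * σ ^ 2) ≤ R := fun b => by
    have hpS := isProbabilityMeasure_dataLaw covS σ (hf (θS b))
    have hpT := isProbabilityMeasure_dataLaw covT σ (hf (θT b))
    refine le_trans ?_ (le_iSup₂_of_le _ (hmem b) le_rfl)
    have hF : Measurable fun st : (Fin nS → Example d k) × (Fin nT → Example d k) =>
        ∑ i, ENNReal.ofReal ((a i st - δ * bitSign (b i)) ^ 2) := by fun_prop
    have hF' : ∀ x, Measurable fun t : Fin nT → Example d k =>
        ∑ i, ENNReal.ofReal ((a i (x, t) - δ * bitSign (b i)) ^ 2) := fun x =>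
      hF.comp measurable_prodMk_left
    have hpt : ∀ x t, ENNReal.ofReal c * (∑ i, ENNReal.ofReal ((a i (x, t) - δ * bitSign (b i)) ^ 2))
        + ENNReal.ofReal (k * σ ^ 2) ≤ genError f (dataLaw covT σ (f (θT b))) (est x t) := by
      intro x t
      rw [genError_dataLaw covT σ hf]
      gcongr
      rw [← ENNReal.ofReal_sum_of_nonneg fun _ _ => sq_nonneg _, ← ENNReal.ofReal_mul hc]
      have h1 := hL (est x t) (θT b)
      have h2 : ∀ y, ‖f (θT b) y - f (est x t) y‖ₑ = ‖f (est x t) y - f (θT b) y‖ₑ := fun y => by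
        rw [← neg_sub, enorm_neg]
      simp_rw [h2]
      refine le_trans (ENNReal.ofReal_le_ofReal ?_) h1
      exact mul_le_mul_of_nonneg_left (hlow _ _) hc
    refine le_trans (le_of_eq ?_) (lintegral_mono fun x => lintegral_mono fun t => hpt x t)
    have hadd : ∀ x, ∫⁻ t, (ENNReal.ofReal c *
          (∑ i, ENNReal.ofReal ((a i (x, t) - δ * bitSign (b i)) ^ 2)) + ENNReal.ofReal (k * σ ^ 2))
          ∂(Measure.pi fun _ : Fin nT => dataLaw covT σ (f (θT b))) =
        ENNReal.ofReal c * (∫⁻ t, ∑ i, ENNReal.ofReal ((a i (x, t) - δ * bitSign (b i)) ^ 2)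
          ∂(Measure.pi fun _ : Fin nT => dataLaw covT σ (f (θT b)))) + ENNReal.ofReal (k * σ ^ 2) := by
      intro x
      rw [lintegral_add_right _ measurable_const, lintegral_const_mul _ (hF' x), lintegral_const,
        measure_univ, mul_one]
    simp_rw [hadd]
    rw [lintegral_add_right _ measurable_const, lintegral_const_mul _ hF.lintegral_prod_right',
      lintegral_const, measure_univ, mul_one, lintegral_sample covS covT hv hvσ (hf _) (hf _) hF]
    simp_rw [Finset.sum_mul]
    have hm : ∀ i, Measurable fun ω =>
        ENNReal.ofReal ((a i ω - δ * bitSign (b i)) ^ 2) * dens b ω :=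
      fun i => Measurable.mul (by fun_prop) (hdens b)
    rw [← lintegral_finsetSum _ fun i _ => hm i]
  -- The average over vertices is kept as a sum, and this finite nonzero count is cancelled at the
  -- end.
  set N : ℝ≥0∞ := (Fintype.card (ι → Bool) : ℝ≥0∞) with hN
  have hN0 : N ≠ 0 := by simp [hN]
  have hNt : N ≠ ⊤ := by simp [hN]
  have hsum : N * (ENNReal.ofReal c * (Fintype.card ι *
      ENNReal.ofReal (δ ^ 2 * (1 - 2 * (nS * aS + nT * aT)))) + ENNReal.ofReal (k * σ ^ 2)) ≤
      N * R := by
    calc _ = ENNReal.ofReal c * (N * (Fintype.card ι *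
          ENNReal.ofReal (δ ^ 2 * (1 - 2 * (nS * aS + nT * aT))))) +
            N * ENNReal.ofReal (k * σ ^ 2) := by ring
      _ ≤ ENNReal.ofReal c * (∑ b : ι → Bool, ∑ i,
            ∫⁻ ω, ENNReal.ofReal ((a i ω - δ * bitSign (b i)) ^ 2) * dens b ω ∂μ) +
            N * ENNReal.ofReal (k * σ ^ 2) := by gcongr
      _ = ∑ b : ι → Bool, (ENNReal.ofReal c * ∑ i,
            ∫⁻ ω, ENNReal.ofReal ((a i ω - δ * bitSign (b i)) ^ 2) * dens b ω ∂μ +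
            ENNReal.ofReal (k * σ ^ 2)) := by
          rw [Finset.sum_add_distrib, Finset.mul_sum, Finset.sum_const, Finset.card_univ,
            nsmul_eq_mul]
      _ ≤ ∑ _b : ι → Bool, R := Finset.sum_le_sum fun b _ => hrisk b
      _ = N * R := by rw [Finset.sum_const, Finset.card_univ, nsmul_eq_mul]
  refine le_trans ?_ ((ENNReal.mul_le_mul_iff_right hN0 hNt).1 hsum)
  refine ENNReal.ofReal_add_le.trans (add_le_add_left (le_of_eq ?_) _)
  rw [ENNReal.ofReal_mul hc, ← hcard, ENNReal.ofReal_mul (by positivity), ENNReal.ofReal_natCast]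
  congr 4
  rw [haS, haT, ← hvσ]
  field_simp
  ring

/-- The function t(1 - at) has maximum 1/(4a) at t = 1/(2a). Take t = δ² there when the constraint
permits; otherwise let δ² saturate the constraint. -/
theorem lowerB_le_hypercube {σ D rS rT Δ : ℝ} {nS nT : ℕ} (hσ : 0 < σ) (hD : 20 ≤ D)
    (hrS : 0 ≤ rS) (hrT : 0 < rT) (hnT : 0 < nT) (hΔ : 0 ≤ Δ) :
    ∃ τ δ : ℝ, (1 - τ) ^ 2 * δ ^ 2 * (D + 1) ≤ Δ ^ 2 ∧
      lowerB σ D rS rT nS nT Δ ≤ (D + 1) * (δ ^ 2 *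
        (1 - (τ ^ 2 * (rS * nS) + rT * nT) * δ ^ 2 / σ ^ 2)) := by
  have hn : (0 : ℝ) < nT := by exact_mod_cast hnT
  have hNT : 0 < rT * nT := by positivity
  have hN : 0 < rS * nS + rT * nT := by positivity
  have hl1 := Real.log_two_gt_d9
  have hl2 := Real.log_two_lt_d9
  have hD0 : 0 < D := by linarith
  unfold lowerB
  split_ifs with h1 h2
  · have h1' : σ ^ 2 * D * Real.log 2 / (rT * nT) ≤ Δ ^ 2 := (Real.sqrt_le_left hΔ).1 h1
    -- Unconstrained optimum for τ = 0. It is admissible because (D + 1)/2 ≤ D log 2 for D ≥ 20.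
    refine ⟨0, √(σ ^ 2 / (2 * (rT * nT))), ?_, ?_⟩
    · rw [Real.sq_sqrt (by positivity)]
      refine le_trans ?_ h1'
      have : (1 - 0) ^ 2 * (σ ^ 2 / (2 * (rT * nT))) * (D + 1) =
        σ ^ 2 * ((D + 1) / 2) / (rT * nT) := by field_simp; ring
      rw [this, mul_assoc]
      gcongr
      nlinarith
    · rw [Real.sq_sqrt (by positivity)]
      have : (D + 1) * (σ ^ 2 / (2 * (rT * nT)) *
          (1 - (0 ^ 2 * (rS * nS) + rT * nT) * (σ ^ 2 / (2 * (rT * nT))) / σ ^ 2)) =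
          σ ^ 2 * ((D + 1) / 4) / (rT * nT) := by field_simp; ring
      rw [this, show σ ^ 2 * D / (256 * rT * nT) = σ ^ 2 * (D / 256) / (rT * nT) by field_simp]
      gcongr <;> linarith
  · have h1' : Δ ^ 2 < σ ^ 2 * D * Real.log 2 / (rT * nT) := (Real.lt_sqrt hΔ).1 (not_le.1 h1)
    -- The transfer constraint holds with equality.
    refine ⟨0, √(Δ ^ 2 / (D + 1)), ?_, ?_⟩
    · rw [Real.sq_sqrt (by positivity)]
      refine le_of_eq ?_
      field_simp
      ring
    · rw [Real.sq_sqrt (by positivity)]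
      set u := rT * nT * Δ ^ 2 / (σ ^ 2 * D) with hu
      -- Since log 2 < 0.7, the factor 1 - u stays above 0.3 and dominates (1 - 0.8u)/100.
      have hu1 : u ≤ 0.7 := by
        rw [hu, div_le_iff₀ (by positivity)]
        rw [lt_div_iff₀ hNT] at h1'
        have : 0 < σ ^ 2 * D := by positivity
        nlinarith
      have hu2 : (0 ^ 2 * (rS * nS) + rT * nT) * (Δ ^ 2 / (D + 1)) / σ ^ 2 ≤ u := by
        rw [hu]
        have : (0 ^ 2 * (rS * nS) + rT * nT) * (Δ ^ 2 / (D + 1)) / σ ^ 2 =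
          rT * nT * Δ ^ 2 / (σ ^ 2 * (D + 1)) := by field_simp; ring
        rw [this]
        gcongr
        linarith
      have hu0 : 0 ≤ u := by positivity
      have : (D + 1) * (Δ ^ 2 / (D + 1) *
          (1 - (0 ^ 2 * (rS * nS) + rT * nT) * (Δ ^ 2 / (D + 1)) / σ ^ 2)) =
          Δ ^ 2 * (1 - (0 ^ 2 * (rS * nS) + rT * nT) * (Δ ^ 2 / (D + 1)) / σ ^ 2) := by
        rw [← mul_assoc, mul_div_cancel₀ _ (by positivity)]
      rw [this, mul_comm (1 / 100 : ℝ), mul_assoc]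
      gcongr
      linarith
  · have h2' : (45 * Δ) ^ 2 ≤ σ ^ 2 * D / (rS * nS + rT * nT) := by
      refine ((Real.lt_sqrt (by positivity)).1 ?_).le
      linarith
    -- Source and target parameters coincide, so δ is free and the optimum uses both samples. The Δ²
    -- in the bound is absorbed through Δ² ≤ σ²D/(2025(rS nS + rT nT)).
    refine ⟨1, √(σ ^ 2 / (2 * (rS * nS + rT * nT))), ?_, ?_⟩
    · simp; positivity
    · rw [Real.sq_sqrt (by positivity)]
      have : (D + 1) * (σ ^ 2 / (2 * (rS * nS + rT * nT)) *
          (1 - (1 ^ 2 * (rS * nS) + rT * nT) * (σ ^ 2 / (2 * (rS * nS + rT * nT))) / σ ^ 2)) =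
          (D * σ ^ 2 / (rS * nS + rT * nT) + σ ^ 2 / (rS * nS + rT * nT)) / 4 := by
        field_simp; ring
      rw [this]
      have h3 : 0 ≤ σ ^ 2 / (rS * nS + rT * nT) := by positivity
      have h4 : 0 ≤ D * σ ^ 2 / (rS * nS + rT * nT) := by positivity
      rw [mul_comm (σ ^ 2) D] at h2'
      linarith

theorem lowerB_le_minimaxRisk {σ : ℝ} (hσ : 0 ≤ σ)
    (hAT : AT.PosSemidef) (hf : ∀ θ, Measurable (f θ)) (hs : 0 ≤ s) (hc : 0 ≤ c)
    (hUS : ∀ M M', ∫⁻ x, ‖f M x - f M' x‖ₑ ^ 2 ∂(multivariateGaussian 0 covS) ≤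
      ENNReal.ofReal (s * transferDist AS M M' ^ 2))
    (hUT : ∀ M M', ∫⁻ x, ‖f M x - f M' x‖ₑ ^ 2 ∂(multivariateGaussian 0 covT) ≤
      ENNReal.ofReal (s * transferDist AT M M' ^ 2))
    (hL : ∀ M M', ENNReal.ofReal (c * transferDist AT M M' ^ 2) ≤
      ∫⁻ x, ‖f M x - f M' x‖ₑ ^ 2 ∂(multivariateGaussian 0 covT))
    (nS : ℕ) {nT : ℕ} (hnT : 0 < nT) {Δ : ℝ} (hΔ : 0 ≤ Δ) (hD : 20 ≤ effDim AT p) :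
    ENNReal.ofReal (c * lowerB σ (effDim AT p) (covRatio AS AT * s) s nS nT Δ + k * σ ^ 2) ≤
      minimaxRisk covS covT σ f (transferDist AT) nS nT Δ := by
  -- For σ = 0 the first threshold is 0, so the first branch applies and the whole bound is 0.
  rcases hσ.eq_or_lt with rfl | hσ
  · simp [lowerB, hΔ]
  -- For s = 0 division by zero yields 0, so `lowerB` is 0; the degenerate cube δ = 0 supplies kσ².
  rcases hs.eq_or_lt with rfl | hs'
  · have := hypercube_le_minimaxRisk hσ hAT hf le_rfl hc hUS hUT hL nS nT hΔ (τ := 0) (δ := 0)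
      (by simpa using sq_nonneg Δ)
    simpa [lowerB, hΔ] using this
  obtain ⟨τ, δ, h1, h2⟩ := lowerB_le_hypercube (nS := nS) hσ hD
    (mul_nonneg (sq_nonneg _) hs : 0 ≤ covRatio AS AT * s) hs' hnT hΔ
  refine le_trans (ENNReal.ofReal_le_ofReal ?_)
    (hypercube_le_minimaxRisk hσ hAT hf hs hc hUS hUT hL nS nT hΔ h1)
  gcongr

end General

/-! ### The arc-cosine kernel -/

/-- The joint law of two linear functionals of a standard Gaussian vector depends only on their
Gram matrix. -/
theorem map_inner_prod_stdGaussian {E F : Type*} [NormedAddCommGroup E] [InnerProductSpace ℝ E]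
    [FiniteDimensional ℝ E] [MeasurableSpace E] [BorelSpace E] [NormedAddCommGroup F]
    [InnerProductSpace ℝ F] [FiniteDimensional ℝ F] [MeasurableSpace F] [BorelSpace F]
    {a b : E} {a' b' : F} (haa : inner ℝ a a = inner ℝ a' a') (hab : inner ℝ a b = inner ℝ a' b')
    (hbb : inner ℝ b b = inner ℝ b' b') :
    (stdGaussian E).map (fun x => (inner ℝ a x, inner ℝ b x)) =
      (stdGaussian F).map (fun x => (inner ℝ a' x, inner ℝ b' x)) := by
  have hE : (fun x : E => (inner ℝ a x, inner ℝ b x)) = (innerSL ℝ a).prod (innerSL ℝ b) := rfl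
  have hF : (fun x : F => (inner ℝ a' x, inner ℝ b' x)) = (innerSL ℝ a').prod (innerSL ℝ b') := rfl
  apply Measure.ext_of_charFunDual
  ext L
  have hLE : L.comp ((innerSL ℝ a).prod (innerSL ℝ b)) = innerSL ℝ (L (1, 0) • a + L (0, 1) • b) := by
    ext x
    have : (inner ℝ a x, inner ℝ b x) = inner ℝ a x • ((1 : ℝ), (0 : ℝ)) + inner ℝ b x • (0, 1) := by
      simp
    change L (inner ℝ a x, inner ℝ b x) = inner ℝ (L (1, 0) • a + L (0, 1) • b) x
    rw [this, map_add, map_smul, map_smul, inner_add_left, real_inner_smul_left,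
      real_inner_smul_left, smul_eq_mul, smul_eq_mul]
    ring
  have hLF : L.comp ((innerSL ℝ a').prod (innerSL ℝ b')) =
      innerSL ℝ (L (1, 0) • a' + L (0, 1) • b') := by
    ext x
    have : (inner ℝ a' x, inner ℝ b' x) =
        inner ℝ a' x • ((1 : ℝ), (0 : ℝ)) + inner ℝ b' x • (0, 1) := by simp
    change L (inner ℝ a' x, inner ℝ b' x) = inner ℝ (L (1, 0) • a' + L (0, 1) • b') x
    rw [this, map_add, map_smul, map_smul, inner_add_left, real_inner_smul_left,
      real_inner_smul_left, smul_eq_mul, smul_eq_mul]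
    ring
  rw [hE, hF, charFunDual_map, charFunDual_map, charFunDual_stdGaussian, charFunDual_stdGaussian,
    hLE, hLF, innerSL_apply_norm, innerSL_apply_norm]
  congr 3
  norm_cast
  rw [← real_inner_self_eq_norm_sq, ← real_inner_self_eq_norm_sq]
  simp only [inner_add_left, inner_add_right, real_inner_smul_left, real_inner_smul_right]
  rw [real_inner_comm a b, real_inner_comm a' b', haa, hab, hbb]

/-- Both factors are nonnegative cosines only on [θ - π/2, π/2]. There cos t cos(t - θ) = (cos(2t -
θ) + cos θ)/2 has an elementary primitive; elsewhere the integrand vanishes. -/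
theorem integral_relu_cos_mul_relu_cos {θ : ℝ} (h0 : 0 ≤ θ) (hπ : θ ≤ Real.pi) :
    ∫ t in Set.Ioo (-Real.pi) Real.pi, max (Real.cos t) 0 * max (Real.cos (t - θ)) 0 =
      (Real.sin θ + (Real.pi - θ) * Real.cos θ) / 2 := by
  have hp := Real.pi_pos
  set F : ℝ → ℝ := fun t => max (Real.cos t) 0 * max (Real.cos (t - θ)) 0 with hF
  have hcont : Continuous F := by fun_prop
  have hii : ∀ a b, IntervalIntegrable F volume a b := fun a b => hcont.intervalIntegrable a b
  have hz1 : ∫ t in (-Real.pi)..(-(Real.pi / 2)), F t = 0 := by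
    rw [intervalIntegral.integral_congr (g := fun _ => 0)]
    · simp
    · intro t ht
      rw [Set.uIcc_of_le (by linarith)] at ht
      have : Real.cos t ≤ 0 := by
        rw [← Real.cos_neg]
        exact Real.cos_nonpos_of_pi_div_two_le_of_le (by linarith [ht.2]) (by linarith [ht.1])
      simp [hF, this]
  have hz2 : ∫ t in (-(Real.pi / 2))..(θ - Real.pi / 2), F t = 0 := by
    rw [intervalIntegral.integral_congr (g := fun _ => 0)]
    · simp
    · intro t ht
      rw [Set.uIcc_of_le (by linarith)] at ht
      have : Real.cos (t - θ) ≤ 0 := by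
        rw [← Real.cos_neg]
        exact Real.cos_nonpos_of_pi_div_two_le_of_le (by linarith [ht.2]) (by linarith [ht.1])
      simp [hF, this]
  have hz3 : ∫ t in (Real.pi / 2)..Real.pi, F t = 0 := by
    rw [intervalIntegral.integral_congr (g := fun _ => 0)]
    · simp
    · intro t ht
      rw [Set.uIcc_of_le (by linarith)] at ht
      have : Real.cos t ≤ 0 :=
        Real.cos_nonpos_of_pi_div_two_le_of_le (by linarith [ht.1]) (by linarith [ht.2])
      simp [hF, this]
  have hmain : ∫ t in (θ - Real.pi / 2)..(Real.pi / 2), F t =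
      (Real.sin θ + (Real.pi - θ) * Real.cos θ) / 2 := by
    have hderiv : ∀ t ∈ Set.uIcc (θ - Real.pi / 2) (Real.pi / 2),
        HasDerivAt (fun t => Real.sin (2 * t - θ) / 4 + t * (Real.cos θ / 2)) (F t) t := by
      intro t ht
      rw [Set.uIcc_of_le (by linarith)] at ht
      have hc1 : 0 ≤ Real.cos t := Real.cos_nonneg_of_mem_Icc ⟨by linarith [ht.1], ht.2⟩
      have hc2 : 0 ≤ Real.cos (t - θ) :=
        Real.cos_nonneg_of_mem_Icc ⟨by linarith [ht.1], by linarith [ht.2]⟩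
      have h1 : HasDerivAt (fun t : ℝ => 2 * t - θ) (2 * 1) t :=
        ((hasDerivAt_id t).const_mul 2).sub_const θ
      have h2 := (h1.sin.div_const 4).add ((hasDerivAt_id t).mul_const (Real.cos θ / 2))
      refine h2.congr_deriv ?_
      simp only [hF, max_eq_left hc1, max_eq_left hc2]
      have e1 : Real.cos (2 * t - θ) = Real.cos t * Real.cos (t - θ) - Real.sin t * Real.sin (t - θ) := by
        rw [← Real.cos_add]; congr 1; ring
      have e2 : Real.cos θ = Real.cos t * Real.cos (t - θ) + Real.sin t * Real.sin (t - θ) := by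
        rw [← Real.cos_sub]; congr 1; ring
      rw [e1, e2]
      ring
    rw [intervalIntegral.integral_eq_sub_of_hasDerivAt hderiv (hii _ _)]
    have e1 : Real.sin (2 * (Real.pi / 2) - θ) = Real.sin θ := by
      rw [← Real.sin_pi_sub θ]; congr 1; ring
    have e2 : Real.sin (2 * (θ - Real.pi / 2) - θ) = -Real.sin θ := by
      rw [← Real.sin_sub_pi θ]; congr 1; ring
    rw [e1, e2]
    ring
  rw [← integral_Ioc_eq_integral_Ioo, ← intervalIntegral.integral_of_le (by linarith),
    ← intervalIntegral.integral_add_adjacent_intervals (hii (-Real.pi) (-(Real.pi / 2))) (hii _ _),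
    ← intervalIntegral.integral_add_adjacent_intervals (hii (-(Real.pi / 2)) (θ - Real.pi / 2))
      (hii _ _),
    ← intervalIntegral.integral_add_adjacent_intervals (hii (θ - Real.pi / 2) (Real.pi / 2))
      (hii _ _), hz1, hz2, hz3, hmain]
  ring

theorem integral_pow_three_mul_exp :
    ∫ r in Set.Ioi (0 : ℝ), r ^ 3 * Real.exp (-(r ^ 2 / 2)) = 2 := by
  have h := integral_rpow_mul_exp_neg_mul_rpow (p := 2) (q := 3) (b := 1 / 2) (by norm_num)
    (by norm_num) (by norm_num)
  have e : ∀ r : ℝ, r ^ (3 : ℝ) * Real.exp (-(1 / 2) * r ^ (2 : ℝ)) =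
      r ^ 3 * Real.exp (-(r ^ 2 / 2)) := fun r => by
    rw [show (3 : ℝ) = (3 : ℕ) by norm_num, show (2 : ℝ) = (2 : ℕ) by norm_num, Real.rpow_natCast,
      Real.rpow_natCast]
    congr 2
    push_cast
    ring
  simp_rw [e] at h
  rw [h, show ((3 : ℝ) + 1) / 2 = 2 by norm_num, Real.Gamma_two,
    show -((3 : ℝ) + 1) / 2 = ((-2 : ℤ) : ℝ) by norm_num, Real.rpow_intCast]
  norm_num

theorem integral_gaussianReal_prod (F : ℝ × ℝ → ℝ) :
    ∫ z, F z ∂((gaussianReal 0 1).prod (gaussianReal 0 1)) =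
      ∫ z : ℝ × ℝ, (2 * Real.pi)⁻¹ * Real.exp (-((z.1 ^ 2 + z.2 ^ 2) / 2)) * F z := by
  rw [gaussianReal_of_var_ne_zero _ one_ne_zero, prod_withDensity (measurable_gaussianPDF _ _)
    (measurable_gaussianPDF _ _), ← Measure.volume_eq_prod,
    integral_withDensity_eq_integral_toReal_smul (f := fun z : ℝ × ℝ =>
        gaussianPDF 0 1 z.1 * gaussianPDF 0 1 z.2) (by fun_prop)
      (ae_of_all _ fun z => ENNReal.mul_lt_top gaussianPDF_lt_top gaussianPDF_lt_top)]
  refine integral_congr_ae (ae_of_all _ fun z => ?_)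
  simp only [ENNReal.toReal_mul, toReal_gaussianPDF, smul_eq_mul]
  congr 1
  simp only [gaussianPDFReal, NNReal.coe_one, mul_one, sub_zero]
  have h2 : (√(2 * Real.pi))⁻¹ * (√(2 * Real.pi))⁻¹ = (2 * Real.pi)⁻¹ := by
    rw [← mul_inv, Real.mul_self_sqrt (by positivity)]
  rw [← h2, show -((z.1 ^ 2 + z.2 ^ 2) / 2) = -z.1 ^ 2 / 2 + -z.2 ^ 2 / 2 by ring, Real.exp_add]
  ring

/-- Positive homogeneity of ReLU separates radius from angle in polar coordinates. Each ReLU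
contributes a factor r and the Jacobian a third, hence the radial moment r³. -/
theorem integral_relu_mul_relu_polar {θ : ℝ} (h0 : 0 ≤ θ) (hπ : θ ≤ Real.pi) :
    ∫ z : ℝ × ℝ, max z.1 0 * max (Real.cos θ * z.1 + Real.sin θ * z.2) 0
        ∂((gaussianReal 0 1).prod (gaussianReal 0 1)) =
      1 / 2 * ((Real.sin θ + (Real.pi - θ) * Real.cos θ) / Real.pi) := by
  rw [integral_gaussianReal_prod, ← integral_comp_polarCoord_symm]
  have hpt : ∀ z ∈ polarCoord.target, z.1 • ((2 * Real.pi)⁻¹ *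
      Real.exp (-(((polarCoord.symm z).1 ^ 2 + (polarCoord.symm z).2 ^ 2) / 2)) *
      (max (polarCoord.symm z).1 0 *
        max (Real.cos θ * (polarCoord.symm z).1 + Real.sin θ * (polarCoord.symm z).2) 0)) =
      (z.1 ^ 3 * Real.exp (-(z.1 ^ 2 / 2))) * ((2 * Real.pi)⁻¹ *
        (max (Real.cos z.2) 0 * max (Real.cos (z.2 - θ)) 0)) := by
    intro z hz
    have hr : 0 < z.1 := hz.1
    have h1 : max (z.1 * Real.cos z.2) 0 = z.1 * max (Real.cos z.2) 0 := by
      rw [mul_max_of_nonneg _ _ hr.le, mul_zero]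
    have h2 : max (Real.cos θ * (z.1 * Real.cos z.2) + Real.sin θ * (z.1 * Real.sin z.2)) 0 =
        z.1 * max (Real.cos (z.2 - θ)) 0 := by
      rw [mul_max_of_nonneg _ _ hr.le, mul_zero, Real.cos_sub]
      congr 1; ring
    have h3 : (z.1 * Real.cos z.2) ^ 2 + (z.1 * Real.sin z.2) ^ 2 = z.1 ^ 2 := by
      linear_combination z.1 ^ 2 * Real.cos_sq_add_sin_sq z.2
    simp only [polarCoord_symm_apply, smul_eq_mul]
    rw [h1, h2, h3]
    ring
  rw [setIntegral_congr_fun polarCoord.open_target.measurableSet hpt, polarCoord_target,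
    Measure.volume_eq_prod, setIntegral_prod_mul (fun r : ℝ => r ^ 3 * Real.exp (-(r ^ 2 / 2)))
      (fun t : ℝ => (2 * Real.pi)⁻¹ * (max (Real.cos t) 0 * max (Real.cos (t - θ)) 0)),
    integral_pow_three_mul_exp, integral_const_mul, integral_relu_cos_mul_relu_cos h0 hπ]
  field_simp

theorem map_fin_two_stdGaussian :
    (stdGaussian (EuclideanSpace ℝ (Fin 2))).map (fun x => (x 0, x 1)) =
      (gaussianReal 0 1).prod (gaussianReal 0 1) := by
  rw [← map_pi_eq_stdGaussian, Measure.map_map (by fun_prop) (by fun_prop)]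
  exact (measurePreserving_finTwoArrow (gaussianReal 0 1)).map_eq

/-- The arc-cosine kernel of order one. -/
theorem integral_relu_inner_mul_relu_inner {E : Type*} [NormedAddCommGroup E]
    [InnerProductSpace ℝ E] [FiniteDimensional ℝ E] [MeasurableSpace E] [BorelSpace E] (a b : E) :
    ∫ x, max (inner ℝ a x) 0 * max (inner ℝ b x) 0 ∂(stdGaussian E) =
      1 / 2 * ‖a‖ * ‖b‖ * ((√(1 - (inner ℝ a b / (‖a‖ * ‖b‖)) ^ 2) +
        (Real.pi - Real.arccos (inner ℝ a b / (‖a‖ * ‖b‖))) * (inner ℝ a b / (‖a‖ * ‖b‖))) /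
          Real.pi) := by
  set γ : ℝ := inner ℝ a b / (‖a‖ * ‖b‖) with hγ
  rcases eq_or_ne a 0 with rfl | ha
  · simp
  rcases eq_or_ne b 0 with rfl | hb
  · simp
  have ha' : 0 < ‖a‖ := norm_pos_iff.2 ha
  have hb' : 0 < ‖b‖ := norm_pos_iff.2 hb
  have hγ1 := abs_le.1 (abs_real_inner_div_norm_mul_norm_le_one a b)
  have hcos : Real.cos (Real.arccos γ) = γ := Real.cos_arccos hγ1.1 hγ1.2
  have hsin : Real.sin (Real.arccos γ) = √(1 - γ ^ 2) := Real.sin_arccos γ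
  set θ := Real.arccos γ with hθ
  -- Only the Gram matrix matters, so the pair is replaced by plane vectors of the same lengths at
  -- the same angle.
  let a' : EuclideanSpace ℝ (Fin 2) := ‖a‖ • !₂[1, 0]
  let b' : EuclideanSpace ℝ (Fin 2) := ‖b‖ • !₂[Real.cos θ, Real.sin θ]
  have inner_two : ∀ x y : EuclideanSpace ℝ (Fin 2), inner ℝ x y = x 0 * y 0 + x 1 * y 1 :=
    fun x y => by simp [PiLp.inner_apply, mul_comm]
  have haa : inner ℝ a a = inner ℝ a' a' := by
    rw [inner_two, real_inner_self_eq_norm_sq]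
    simp [a', sq]
  have hab : inner ℝ a b = inner ℝ a' b' := by
    rw [inner_two]
    simp only [a', b', PiLp.smul_apply, smul_eq_mul, hcos, Matrix.cons_val_zero,
      Matrix.cons_val_one]
    rw [hγ]
    field_simp
    ring
  have hbb : inner ℝ b b = inner ℝ b' b' := by
    rw [inner_two, real_inner_self_eq_norm_sq]
    simp only [b', PiLp.smul_apply, smul_eq_mul, Matrix.cons_val_zero,
      Matrix.cons_val_one]
    linear_combination -‖b‖ ^ 2 * Real.cos_sq_add_sin_sq θ
  have hcont : Continuous fun z : ℝ × ℝ => max z.1 0 * max z.2 0 := by fun_prop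
  have h1 : ∫ x, max (inner ℝ a x) 0 * max (inner ℝ b x) 0 ∂(stdGaussian E) =
      ∫ z, max z.1 0 * max z.2 0 ∂((stdGaussian E).map (fun x => (inner ℝ a x, inner ℝ b x))) :=
    (integral_map (φ := fun x => (inner ℝ a x, inner ℝ b x)) (Measurable.aemeasurable (by fun_prop)) hcont.aestronglyMeasurable).symm
  rw [h1, map_inner_prod_stdGaussian haa hab hbb,
    integral_map (φ := fun x => (inner ℝ a' x, inner ℝ b' x))
      (Measurable.aemeasurable (by fun_prop)) hcont.aestronglyMeasurable]
  have h2 : ∀ x : EuclideanSpace ℝ (Fin 2), max (inner ℝ a' x) 0 * max (inner ℝ b' x) 0 =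
      ‖a‖ * ‖b‖ * (max (x 0) 0 * max (Real.cos θ * x 0 + Real.sin θ * x 1) 0) := fun x => by
    have e1 : inner ℝ a' x = ‖a‖ * x 0 := by
      rw [inner_two]; simp [a']
    have e2 : inner ℝ b' x = ‖b‖ * (Real.cos θ * x 0 + Real.sin θ * x 1) := by
      rw [inner_two]; simp [b']; ring
    have e3 : ∀ r t : ℝ, 0 ≤ r → max (r * t) 0 = r * max t 0 := fun r t hr => by
      rw [mul_max_of_nonneg _ _ hr, mul_zero]
    rw [e1, e2, e3 _ _ ha'.le, e3 _ _ hb'.le]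
    ring
  simp_rw [h2]
  have hcont2 : Continuous fun z : ℝ × ℝ =>
      max z.1 0 * max (Real.cos θ * z.1 + Real.sin θ * z.2) 0 := by fun_prop
  have h3 : ∫ x : EuclideanSpace ℝ (Fin 2),
      max (x 0) 0 * max (Real.cos θ * x 0 + Real.sin θ * x 1) 0 ∂(stdGaussian _) =
      ∫ z : ℝ × ℝ, max z.1 0 * max (Real.cos θ * z.1 + Real.sin θ * z.2) 0
        ∂((stdGaussian (EuclideanSpace ℝ (Fin 2))).map (fun x => (x 0, x 1))) :=
    (integral_map
      (φ := fun x : EuclideanSpace ℝ (Fin 2) => (x 0, x 1)) (Measurable.aemeasurable (by fun_prop)) hcont2.aestronglyMeasurable).symm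
  rw [integral_const_mul, h3, map_fin_two_stdGaussian,
    integral_relu_mul_relu_polar (Real.arccos_nonneg γ) (Real.arccos_le_pi γ), ← hsin, ← hθ, hcos]
  ring

/-! ### The three models -/

/-- In an eigenbasis of T*T, ‖Tz‖² is a weighted sum of squared coordinates; singular values are
antitone, so each weight is at least the square of the last one. -/
theorem minSingularValue_mul_norm_le {k l : ℕ} (hl : 0 < l) (V : Matrix (Fin k) (Fin l) ℝ)
    (z : EuclideanSpace ℝ (Fin l)) :
    minSingularValue V * ‖z‖ ≤ ‖Matrix.toEuclideanLin V z‖ := by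
  set T := Matrix.toEuclideanLin V with hT
  have hn : Module.finrank ℝ (EuclideanSpace ℝ (Fin l)) = l := by simp
  have hsym := T.isSymmetric_adjoint_comp_self
  set b := hsym.eigenvectorBasis hn with hb
  have hsq : (minSingularValue V * ‖z‖) ^ 2 ≤ ‖T z‖ ^ 2 := by
    have h1 : ‖T z‖ ^ 2 = ∑ i, hsym.eigenvalues hn i * inner ℝ (b i) z ^ 2 := by
      rw [← real_inner_self_eq_norm_sq, ← LinearMap.adjoint_inner_left, ← LinearMap.comp_apply,
        ← b.sum_inner_mul_inner]
      refine Finset.sum_congr rfl fun i _ => ?_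
      rw [hsym, hsym.apply_eigenvectorBasis hn i]
      change inner ℝ z (hsym.eigenvalues hn i • b i) * _ = _
      rw [real_inner_smul_right, real_inner_comm]
      ring
    rw [h1, mul_pow, ← b.sum_sq_inner_right, Finset.mul_sum]
    refine Finset.sum_le_sum fun i _ => mul_le_mul_of_nonneg_right ?_ (sq_nonneg _)
    rw [← T.sq_singularValues_fin hn i]
    exact pow_le_pow_left₀ (T.singularValues_nonneg _)
      (T.singularValues_antitone (by have := i.2; omega)) 2
  exact (abs_le_of_sq_le_sq' hsq (norm_nonneg _)).2

@[fun_prop]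
theorem measurable_reluVec {n : ℕ} : Measurable (reluVec (n := n)) := by
  have : reluVec (n := n) = (WithLp.toLp 2) ∘ fun x i => max (x i) 0 := rfl
  rw [this]
  refine (by fun_prop : Measurable (WithLp.toLp 2)).comp ?_
  exact measurable_pi_lambda _ fun i => by fun_prop

@[fun_prop]
theorem measurable_toEuclideanLin {m n : ℕ} (M : Matrix (Fin m) (Fin n) ℝ) :
    Measurable (Matrix.toEuclideanLin M) :=
  (LinearMap.continuous_of_finiteDimensional _).measurable

theorem lintegral_enorm_sq_linear {d p : ℕ} {S : Matrix (Fin d) (Fin d) ℝ} (hS : S.PosSemidef)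
    (M M' : Matrix (Fin p) (Fin d) ℝ) :
    ∫⁻ x, ‖Matrix.toEuclideanLin M x - Matrix.toEuclideanLin M' x‖ₑ ^ 2
      ∂(multivariateGaussian 0 S) = ENNReal.ofReal (transferDist S M M' ^ 2) := by
  rw [sq_transferDist_eq_quadratic hS, ← lintegral_enorm_sq_toEuclideanLin (ψ := id)
    (memLp_eval_multivariateGaussian S) (integral_eval_mul_eval_multivariateGaussian hS)]
  simp

theorem enorm_sq_reluVec_sub_le {n : ℕ} (x y : EuclideanSpace ℝ (Fin n)) :
    ‖reluVec x - reluVec y‖ₑ ^ 2 ≤ ‖x - y‖ₑ ^ 2 := by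
  simp only [← ofReal_norm, ← ENNReal.ofReal_pow (norm_nonneg _)]
  refine ENNReal.ofReal_le_ofReal ?_
  rw [EuclideanSpace.real_norm_sq_eq, EuclideanSpace.real_norm_sq_eq]
  refine Finset.sum_le_sum fun i _ => ?_
  exact sq_le_sq.2 (abs_max_sub_max_le_abs (x i) (y i) 0)

/-- Since a = max(a, 0) - max(-a, 0), this is (x - y)² ≤ 2(x² + y²). -/
theorem half_sq_sub_le_relu (a b : ℝ) :
    1 / 2 * (a - b) ^ 2 ≤
      (max a 0 - max b 0) ^ 2 + (max (-a) 0 - max (-b) 0) ^ 2 := by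
  rcases le_total 0 a with ha | ha <;> rcases le_total 0 b with hb | hb <;>
    simp only [max_eq_left, max_eq_right, ha, hb, Left.neg_nonpos_iff, Left.nonneg_neg_iff] <;>
    nlinarith [sq_nonneg (a - b), sq_nonneg (a + b)]

theorem half_enorm_sq_sub_le_reluVec {n : ℕ} (x y : EuclideanSpace ℝ (Fin n)) :
    ENNReal.ofReal (1 / 2) * ‖x - y‖ₑ ^ 2 ≤
      ‖reluVec x - reluVec y‖ₑ ^ 2 + ‖reluVec (-x) - reluVec (-y)‖ₑ ^ 2 := by
  simp only [← ofReal_norm, ← ENNReal.ofReal_pow (norm_nonneg _)]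
  rw [← ENNReal.ofReal_add (by positivity) (by positivity), ← ENNReal.ofReal_mul (by positivity)]
  refine ENNReal.ofReal_le_ofReal ?_
  simp only [EuclideanSpace.real_norm_sq_eq]
  rw [Finset.mul_sum, ← Finset.sum_add_distrib]
  exact Finset.sum_le_sum fun i _ => half_sq_sub_le_relu (x i) (y i)

/-- ReLU may collapse differences at x, but x and -x together retain half of the squared difference.
They are equally likely, so a quarter survives on average. -/
theorem lintegral_enorm_sq_reluVec_ge {d p : ℕ} {S : Matrix (Fin d) (Fin d) ℝ} (hS : S.PosSemidef)
    (M M' : Matrix (Fin p) (Fin d) ℝ) :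
    ENNReal.ofReal (1 / 4 * transferDist S M M' ^ 2) ≤
      ∫⁻ x, ‖reluVec (Matrix.toEuclideanLin M x) - reluVec (Matrix.toEuclideanLin M' x)‖ₑ ^ 2
        ∂(multivariateGaussian 0 S) := by
  set F : EuclideanSpace ℝ (Fin d) → ℝ≥0∞ := fun x =>
    ‖reluVec (Matrix.toEuclideanLin M x) - reluVec (Matrix.toEuclideanLin M' x)‖ₑ ^ 2 with hF
  have hFm : Measurable F := by fun_prop
  have h2 : 2 * ENNReal.ofReal (1 / 4 * transferDist S M M' ^ 2) ≤
      2 * ∫⁻ x, F x ∂(multivariateGaussian 0 S) := by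
    have e : 2 * ENNReal.ofReal (1 / 4 * transferDist S M M' ^ 2) =
        ENNReal.ofReal (1 / 2) * ENNReal.ofReal (transferDist S M M' ^ 2) := by
      rw [← ENNReal.ofReal_mul (by positivity), ← ENNReal.ofReal_ofNat 2,
        ← ENNReal.ofReal_mul (by positivity)]
      congr 1; ring
    rw [e, ← lintegral_enorm_sq_linear hS, ← lintegral_const_mul _ (by fun_prop), two_mul]
    nth_rewrite 2 [← lintegral_comp_neg_multivariateGaussian hS hFm]
    rw [← lintegral_add_left hFm]
    refine lintegral_mono fun x => ?_
    simp only [hF, map_neg]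
    exact half_enorm_sq_sub_le_reluVec _ _
  exact (ENNReal.mul_le_mul_iff_right (by simp) (by simp)).1 h2

theorem memLp_relu {d l : ℕ} (W : Matrix (Fin l) (Fin d) ℝ) (S : Matrix (Fin d) (Fin d) ℝ)
    (i : Fin l) :
    MemLp (fun x => reluVec (Matrix.toEuclideanLin W x) i) 2 (multivariateGaussian 0 S) := by
  have h : MemLp (fun x => Matrix.toEuclideanLin W x i) 2 (multivariateGaussian 0 S) :=
    ((EuclideanSpace.proj (𝕜 := ℝ) i).comp
      (LinearMap.toContinuousLinearMap (Matrix.toEuclideanLin W))).comp_memLp'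
      IsGaussian.memLp_two_id
  refine h.mono (Measurable.aestronglyMeasurable (by fun_prop)) (ae_of_all _ fun x => ?_)
  change |max (Matrix.toEuclideanLin W x i) 0| ≤ |Matrix.toEuclideanLin W x i|
  simpa using abs_max_sub_max_le_abs (Matrix.toEuclideanLin W x i) 0 0

/-- The features are √S g with g standard Gaussian, so the pre-activations are inner products of g
with the rows of W√S. -/
theorem integral_relu_mul_relu {d l : ℕ} (W : Matrix (Fin l) (Fin d) ℝ)
    (S : Matrix (Fin d) (Fin d) ℝ) (i j : Fin l) :
    ∫ x, reluVec (Matrix.toEuclideanLin W x) i * reluVec (Matrix.toEuclideanLin W x) j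
      ∂(multivariateGaussian 0 S) = reluCov W S i j := by
  rw [multivariateGaussian, integral_map (by fun_prop)
    (Measurable.aestronglyMeasurable (by fun_prop))]
  have : ∀ (i : Fin l) (g : EuclideanSpace ℝ (Fin d)),
      reluVec (Matrix.toEuclideanLin W (0 + Matrix.toEuclideanCLM (𝕜 := ℝ) (CFC.sqrt S) g)) i =
        max (inner ℝ (WithLp.toLp 2 ((W * CFC.sqrt S) i) : EuclideanSpace ℝ (Fin d)) g) 0 := by
    intro i g
    rw [zero_add]
    change max ((W *ᵥ (CFC.sqrt S *ᵥ g.ofLp)) i) 0 = _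
    rw [Matrix.mulVec_mulVec, EuclideanSpace.inner_eq_star_dotProduct, dotProduct_comm,
      star_trivial]
    rfl
  simp_rw [this]
  rw [integral_relu_inner_mul_relu_inner]
  rfl

theorem lintegral_enorm_sq_fixedInput {d k l : ℕ} (W : Matrix (Fin l) (Fin d) ℝ)
    (S : Matrix (Fin d) (Fin d) ℝ) (M M' : Matrix (Fin k) (Fin l) ℝ) :
    ∫⁻ x, ‖fixedInputModel W M x - fixedInputModel W M' x‖ₑ ^ 2
      ∂(multivariateGaussian 0 S) = ENNReal.ofReal (transferDist (reluCov W S) M M' ^ 2) := by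
  rw [sq_transferDist_eq_quadratic
      (posSemidef_of_secondMoment (memLp_relu W S) (integral_relu_mul_relu W S)),
    ← lintegral_enorm_sq_toEuclideanLin (memLp_relu W S) (integral_relu_mul_relu W S)]
  simp [fixedInputModel]

end TransferLearning

open TransferLearning in
theorem theorem1 (d k : ℕ) (covS covT : Matrix (Fin d) (Fin d) ℝ)
    (hS : covS.PosSemidef) (hT : covT.PosSemidef) (σ : ℝ) (hσ : 0 ≤ σ)
    (nS nT : ℕ) (hnT : 0 < nT) (Δ : ℝ) (hΔ : 0 ≤ Δ) :
    -- linear model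
    (20 ≤ effDim covT k →
      ENNReal.ofReal
          (lowerB σ (effDim covT k) (covRatio covS covT) 1 nS nT Δ + k * σ ^ 2) ≤
        minimaxRisk covS covT σ (linearModel (k := k)) (transferDist covT) nS nT Δ) ∧
    -- one-hidden-layer ReLU network, fixed hidden-to-output layer
    (∀ (l : ℕ) (V : Matrix (Fin k) (Fin l) ℝ), 20 ≤ effDim covT l →
      ENNReal.ofReal
          (1 / 4 * minSingularValue V ^ 2 *
              lowerB σ (effDim covT l) (covRatio covS covT * opNorm V ^ 2) (opNorm V ^ 2) nS nT Δ
            + k * σ ^ 2) ≤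
        minimaxRisk covS covT σ (fixedOutputModel V) (transferDist covT) nS nT Δ) ∧
    -- one-hidden-layer ReLU network, fixed input-to-hidden layer
    (∀ (l : ℕ) (W : Matrix (Fin l) (Fin d) ℝ), 20 ≤ effDim (reluCov W covT) k →
      ENNReal.ofReal
          (lowerB σ (effDim (reluCov W covT) k) (covRatio (reluCov W covS) (reluCov W covT)) 1 nS nT Δ
            + k * σ ^ 2) ≤
        minimaxRisk covS covT σ (fixedInputModel (k := k) W)
          (transferDist (reluCov W covT)) nS nT Δ) := by
  refine ⟨fun hD => ?_, fun l V hD => ?_, fun l W hD => ?_⟩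
  · have := lowerB_le_minimaxRisk (covS := covS) (covT := covT) (AS := covS) (AT := covT)
      (f := linearModel (k := k)) (s := 1) (c := 1) hσ hT (fun M => measurable_toEuclideanLin M)
      zero_le_one zero_le_one
      (fun M M' => by rw [one_mul]; exact (lintegral_enorm_sq_linear hS M M').le)
      (fun M M' => by rw [one_mul]; exact (lintegral_enorm_sq_linear hT M M').le)
      (fun M M' => by rw [one_mul]; exact (lintegral_enorm_sq_linear hT M M').ge) nS hnT hΔ hD
    simpa using this
  -- With no hidden units the effective dimension would be -1.
  · have hl : 0 < l := by
      rcases Nat.eq_zero_or_pos l with rfl | h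
      · norm_num [effDim] at hD
      · exact h
    have hU : ∀ S : Matrix (Fin d) (Fin d) ℝ, S.PosSemidef → ∀ M M',
        ∫⁻ x, ‖fixedOutputModel V M x - fixedOutputModel V M' x‖ₑ ^ 2
          ∂(multivariateGaussian 0 S) ≤
        ENNReal.ofReal (opNorm V ^ 2 * transferDist S M M' ^ 2) := fun S hS M M' => by
      rw [ENNReal.ofReal_mul (sq_nonneg _), ← lintegral_enorm_sq_linear hS,
        ← lintegral_const_mul _ (by fun_prop)]
      refine lintegral_mono fun x => ?_
      refine le_trans ?_ (mul_le_mul_right (enorm_sq_reluVec_sub_le _ _) _)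
      simp only [fixedOutputModel, ← map_sub, ← ofReal_norm,
        ← ENNReal.ofReal_pow (norm_nonneg _)]
      rw [← ENNReal.ofReal_mul (sq_nonneg _), ← mul_pow]
      refine ENNReal.ofReal_le_ofReal (pow_le_pow_left₀ (norm_nonneg _) ?_ 2)
      exact (LinearMap.toContinuousLinearMap (Matrix.toEuclideanLin V)).le_opNorm _
    -- Here s = ‖V‖² produces both transfer coefficients, and c is a quarter of σ_min(V)².
    refine lowerB_le_minimaxRisk hσ hT (fun M => ?_) (sq_nonneg _) (by positivity)
      (hU covS hS) (hU covT hT) (fun M M' => ?_) nS hnT hΔ hD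
    · unfold fixedOutputModel
      fun_prop
    · rw [show 1 / 4 * minSingularValue V ^ 2 * transferDist covT M M' ^ 2 =
        minSingularValue V ^ 2 * (1 / 4 * transferDist covT M M' ^ 2) by ring,
        ENNReal.ofReal_mul (sq_nonneg _)]
      refine (mul_le_mul_right (lintegral_enorm_sq_reluVec_ge hT M M') _).trans ?_
      rw [← lintegral_const_mul _ (by fun_prop)]
      refine lintegral_mono fun x => ?_
      simp only [fixedOutputModel, ← map_sub, ← ofReal_norm,
        ← ENNReal.ofReal_pow (norm_nonneg _)]
      rw [← ENNReal.ofReal_mul (sq_nonneg _), ← mul_pow]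
      refine ENNReal.ofReal_le_ofReal (pow_le_pow_left₀
        (mul_nonneg (LinearMap.singularValues_nonneg _ _) (norm_nonneg _)) ?_ 2)
      exact minSingularValue_mul_norm_le hl V _
  · have := lowerB_le_minimaxRisk (covS := covS) (covT := covT) (AS := reluCov W covS)
      (AT := reluCov W covT) (f := fixedInputModel (k := k) W) (s := 1) (c := 1) hσ
      (posSemidef_of_secondMoment (memLp_relu W covT) (integral_relu_mul_relu W covT))
      (fun M => by unfold fixedInputModel; fun_prop) zero_le_one zero_le_one
      (fun M M' => by rw [one_mul]; exact (lintegral_enorm_sq_fixedInput W covS M M').le)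
      (fun M M' => by rw [one_mul]; exact (lintegral_enorm_sq_fixedInput W covT M M').le)
      (fun M M' => by rw [one_mul]; exact (lintegral_enorm_sq_fixedInput W covT M M').ge)
      nS hnT hΔ hD
    simpa using this
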